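/- Let $n,m,p\ge 0$ be integers. For real matrices $A\in\mathbb R^{n\times n}$, $B\in\mathbb R^{n\times m}$, $C\in\mathbb R^{p\times n}$ consider the discrete-time system $x_{k+1}=Ax_k+Bu_k$, $y_k=Cx_k$. The triple $(A,B,C)$ is called controllable if every state can be steered to every other state in finite time by some input sequence, observable if any two initial states that yield the same output for all input sequences and all times are equal, and minimal if it is controllable and observable. Let $N$ be the set of minimal triples $(A,B,C)$ with $A$ symmetric positive definite; $N$ is an open subset of the vector space $\mathrm{Sym}(n)\times\mathbb R^{n\times m}\times\mathbb R^{p\times n}$ and is regarded as an open submanifold of it. For $U\in O(n)$ and $\Theta=(A,B,C)\in N$ put $U\circ\Theta=(U^TAU,\,U^TB,\,CU)\in N$; this is a right action of the orthogonal group $O(n)$ on $N$. Let $[\Theta]=\{U\circ\Theta \mid U\in O(n)\}$, let $N/O(n)=\{[\Theta]\mid \Theta\in N\}$ carry the quotient topology, and let $\pi:N\to N/O(n)$, $\pi(\Theta)=[\Theta]$. Then: 1. The similarity action $(T,(A,B,C))\mapsto(T^{-1}AT,\,T^{-1}B,\,CT)$ of $GL(n)$ on the set of all minimal triples (with $A$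 an arbitrary real $n\times n$ matrix) is free, that is, all stabilizers are trivial. 2. For every $U\in O(n)$ the map $\Theta\mapsto U\circ\Theta$ is a smooth map $N\to N$, and the action of $O(n)$ on $N$ is free. 3. $O(n)$ is compact, and its action on $N$ is proper, that is, the map $O(n)\times N\to N\times N$, $(U,\Theta)\mapsto(U\circ\Theta,\Theta)$, is proper. 4. $N/O(n)$ is Hausdorff and second countable, and it has a smooth manifold structure of dimension $n(m+p+1)$ $(=\dim N-\dim O(n))$ for which $\pi$ is a smooth submersion; this smooth structure is unique. 5. For every $\Theta\in N$ the fiber $\pi^{-1}([\Theta])$, with the subspace topology, has the structure of a smooth manifold of dimension $n(n-1)/2$ for which the inclusion into $N$ is a smooth embedding; that is, it is an embedded submanifold of $N$. -/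

import Mathlib

open scoped Manifold ContDiff Matrix

namespace SymSys

/-! ### Discrete-time linear systems -/

/-- The state `x_k` of the system `x_{k+1} = A x_k + B u_k` with `x_0 = x` and input sequence
`u`. -/
def state {n m : ℕ} (A : Matrix (Fin n) (Fin n) ℝ) (B : Matrix (Fin n) (Fin m) ℝ)
    (x : Fin n → ℝ) (u : ℕ → Fin m → ℝ) : ℕ → Fin n → ℝ
  | 0 => x
  | k + 1 => A *ᵥ state A B x u k + B *ᵥ u k

/-- Controllability: every state can be steered to every state in finite time. -/
def IsControllable {n m : ℕ} (A : Matrix (Fin n) (Fin n) ℝ) (B : Matrix (Fin n) (Fin m) ℝ) :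
    Prop :=
  ∀ x z : Fin n → ℝ, ∃ (K : ℕ) (u : ℕ → Fin m → ℝ), state A B x u K = z

/-- Observability: two initial states which yield the same output `y_k = C x_k` at all times, for
every input sequence, are equal. -/
def IsObservable {n m p : ℕ} (A : Matrix (Fin n) (Fin n) ℝ) (B : Matrix (Fin n) (Fin m) ℝ)
    (C : Matrix (Fin p) (Fin n) ℝ) : Prop :=
  ∀ x z : Fin n → ℝ,
    (∀ (u : ℕ → Fin m → ℝ) (k : ℕ), C *ᵥ state A B x u k = C *ᵥ state A B z u k) → x = z

/-! ### Change of state coordinates -/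

lemma state_conj {n m : ℕ} {A : Matrix (Fin n) (Fin n) ℝ} {B : Matrix (Fin n) (Fin m) ℝ}
    {S T : Matrix (Fin n) (Fin n) ℝ} (h : T * S = 1) (x : Fin n → ℝ) (u : ℕ → Fin m → ℝ)
    (k : ℕ) : state (S * A * T) (S * B) (S *ᵥ x) u k = S *ᵥ state A B x u k := by
  induction k with
  | zero => rfl
  | succ k ih =>
    have h2 : S * A * T * S = S * A := by rw [Matrix.mul_assoc, h, Matrix.mul_one]
    simp only [state, ih, Matrix.mulVec_add, Matrix.mulVec_mulVec, h2]

lemma IsControllable.conj {n m : ℕ} {A : Matrix (Fin n) (Fin n) ℝ}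
    {B : Matrix (Fin n) (Fin m) ℝ} (hc : IsControllable A B) {S T : Matrix (Fin n) (Fin n) ℝ}
    (h : T * S = 1) : IsControllable (S * A * T) (S * B) := by
  intro x z
  have h' : S * T = 1 := mul_eq_one_comm.mp h
  obtain ⟨K, u, hu⟩ := hc (T *ᵥ x) (T *ᵥ z)
  refine ⟨K, u, ?_⟩
  have := state_conj (A := A) (B := B) h (T *ᵥ x) u K
  rw [hu] at this
  simpa [Matrix.mulVec_mulVec, h'] using this

lemma IsObservable.conj {n m p : ℕ} {A : Matrix (Fin n) (Fin n) ℝ}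
    {B : Matrix (Fin n) (Fin m) ℝ} {C : Matrix (Fin p) (Fin n) ℝ} (ho : IsObservable A B C)
    {S T : Matrix (Fin n) (Fin n) ℝ} (h : T * S = 1) :
    IsObservable (S * A * T) (S * B) (C * T) := by
  intro x z hxz
  have h' : S * T = 1 := mul_eq_one_comm.mp h
  have key : ∀ (x : Fin n → ℝ) (u : ℕ → Fin m → ℝ) (k : ℕ),
      (C * T) *ᵥ state (S * A * T) (S * B) x u k = C *ᵥ state A B (T *ᵥ x) u k := by
    intro x u k
    have := state_conj (A := A) (B := B) h (T *ᵥ x) u k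
    rw [Matrix.mulVec_mulVec, h', Matrix.one_mulVec] at this
    rw [this, Matrix.mulVec_mulVec, Matrix.mul_assoc, h, Matrix.mul_one]
  have hT : T *ᵥ x = T *ᵥ z := ho _ _ fun u k => by rw [← key, ← key, hxz u k]
  have := congrArg (S *ᵥ ·) hT
  simpa [Matrix.mulVec_mulVec, h'] using this

/-! ### Minimal triples and the similarity action of `GL(n)` -/

/-- Controllable and observable (i.e. minimal) triples `(A, B, C)`, with `A` an arbitrary square
matrix. -/
@[ext]
structure MinimalTriple (n m p : ℕ) where
  A : Matrix (Fin n) (Fin n) ℝ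
  B : Matrix (Fin n) (Fin m) ℝ
  C : Matrix (Fin p) (Fin n) ℝ
  controllable : IsControllable A B
  observable : IsObservable A B C

/-- The similarity action `T ↦ (T⁻¹ A T, T⁻¹ B, C T)`. It is a right action of `GL(n)`, that is,
an action of the opposite group. -/
instance instGLAction (n m p : ℕ) : MulAction (GL (Fin n) ℝ)ᵐᵒᵖ (MinimalTriple n m p) where
  smul g Θ :=
    let T : GL (Fin n) ℝ := g.unop
    { A := ((T⁻¹ : GL (Fin n) ℝ) : Matrix (Fin n) (Fin n) ℝ) * Θ.A * (T : Matrix (Fin n) (Fin n) ℝ)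
      B := ((T⁻¹ : GL (Fin n) ℝ) : Matrix (Fin n) (Fin n) ℝ) * Θ.B
      C := Θ.C * (T : Matrix (Fin n) (Fin n) ℝ)
      controllable := Θ.controllable.conj T.mul_inv
      observable := Θ.observable.conj T.mul_inv }
  one_smul Θ := by
    apply MinimalTriple.ext
    · change ((1⁻¹ : GL (Fin n) ℝ) : Matrix (Fin n) (Fin n) ℝ) * Θ.A *
        ((1 : GL (Fin n) ℝ) : Matrix (Fin n) (Fin n) ℝ) = Θ.A
      simp
    · change ((1⁻¹ : GL (Fin n) ℝ) : Matrix (Fin n) (Fin n) ℝ) * Θ.B = Θ.B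
      simp
    · change Θ.C * ((1 : GL (Fin n) ℝ) : Matrix (Fin n) (Fin n) ℝ) = Θ.C
      simp
  mul_smul g h Θ := by
    apply MinimalTriple.ext
    · change (((h.unop * g.unop)⁻¹ : GL (Fin n) ℝ) : Matrix (Fin n) (Fin n) ℝ) * Θ.A *
        ((h.unop * g.unop : GL (Fin n) ℝ) : Matrix (Fin n) (Fin n) ℝ) =
        ((g.unop⁻¹ : GL (Fin n) ℝ) : Matrix (Fin n) (Fin n) ℝ) *
          (((h.unop⁻¹ : GL (Fin n) ℝ) : Matrix (Fin n) (Fin n) ℝ) * Θ.A *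
            (h.unop : Matrix (Fin n) (Fin n) ℝ)) * (g.unop : Matrix (Fin n) (Fin n) ℝ)
      rw [mul_inv_rev, Units.val_mul, Units.val_mul]
      simp only [Matrix.mul_assoc]
    · change (((h.unop * g.unop)⁻¹ : GL (Fin n) ℝ) : Matrix (Fin n) (Fin n) ℝ) * Θ.B =
        ((g.unop⁻¹ : GL (Fin n) ℝ) : Matrix (Fin n) (Fin n) ℝ) *
          (((h.unop⁻¹ : GL (Fin n) ℝ) : Matrix (Fin n) (Fin n) ℝ) * Θ.B)
      rw [mul_inv_rev, Units.val_mul, Matrix.mul_assoc]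
    · change Θ.C * ((h.unop * g.unop : GL (Fin n) ℝ) : Matrix (Fin n) (Fin n) ℝ) =
        Θ.C * (h.unop : Matrix (Fin n) (Fin n) ℝ) * (g.unop : Matrix (Fin n) (Fin n) ℝ)
      rw [Units.val_mul, Matrix.mul_assoc]

/-! ### Openness of controllability, observability and positive definiteness -/

lemma state_sum {n m : ℕ} (A : Matrix (Fin n) (Fin n) ℝ) (B : Matrix (Fin n) (Fin m) ℝ)
    {ι : Type} (s : Finset ι) (c : ι → ℝ) (x : ι → Fin n → ℝ) (u : ι → ℕ → Fin m → ℝ) (k : ℕ) :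
    state A B (∑ i ∈ s, c i • x i) (fun j => ∑ i ∈ s, c i • u i j) k =
      ∑ i ∈ s, c i • state A B (x i) (u i) k := by
  induction k with
  | zero => rfl
  | succ k ih =>
    simp only [state, ih, Matrix.mulVec_sum, Matrix.mulVec_smul, smul_add,
      Finset.sum_add_distrib]

lemma state_add {n m : ℕ} (A : Matrix (Fin n) (Fin n) ℝ) (B : Matrix (Fin n) (Fin m) ℝ)
    (x y : Fin n → ℝ) (u v : ℕ → Fin m → ℝ) (k : ℕ) :
    state A B (x + y) (u + v) k = state A B x u k + state A B y v k := by
  induction k with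
  | zero => rfl
  | succ k ih =>
    simp only [state, ih, Pi.add_apply, Matrix.mulVec_add]
    abel

lemma state_zero_input {n m : ℕ} (A : Matrix (Fin n) (Fin n) ℝ) (B : Matrix (Fin n) (Fin m) ℝ)
    (x : Fin n → ℝ) (k : ℕ) : state A B x 0 k = A ^ k *ᵥ x := by
  induction k with
  | zero => simp [state]
  | succ k ih => simp [state, ih, pow_succ', Matrix.mulVec_mulVec]

lemma state_delay {n m : ℕ} (A : Matrix (Fin n) (Fin n) ℝ) (B : Matrix (Fin n) (Fin m) ℝ)
    (u : ℕ → Fin m → ℝ) (d k : ℕ) :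
    state A B 0 (fun j => if j < d then 0 else u (j - d)) (d + k) = state A B 0 u k := by
  induction k with
  | zero =>
    have : ∀ j ≤ d, state A B 0 (fun j => if j < d then 0 else u (j - d)) j = 0 := by
      intro j
      induction j with
      | zero => intro _; rfl
      | succ j ih =>
        intro hj
        have hj' : j < d := hj
        simp [state, ih hj'.le, hj']
    exact this d le_rfl
  | succ k ih =>
    rw [← Nat.add_assoc]
    simp only [state, ih]
    simp

lemma continuous_state {n m : ℕ} (x : Fin n → ℝ) (u : ℕ → Fin m → ℝ) (k : ℕ) :
    Continuous fun q : Matrix (Fin n) (Fin n) ℝ × Matrix (Fin n) (Fin m) ℝ =>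
      state q.1 q.2 x u k := by
  induction k with
  | zero => exact continuous_const
  | succ k ih =>
    simp only [state]
    exact (continuous_fst.matrix_mulVec ih).add (continuous_snd.matrix_mulVec continuous_const)

lemma isOpen_controllable (n m : ℕ) :
    IsOpen {q : Matrix (Fin n) (Fin n) ℝ × Matrix (Fin n) (Fin m) ℝ | IsControllable q.1 q.2} := by
  rw [isOpen_iff_mem_nhds]
  rintro ⟨A₀, B₀⟩ h₀
  choose K u hu using fun i : Fin n => h₀ 0 (Pi.single i 1)
  let N : ℕ := ∑ i, K i
  have hK : ∀ i, K i ≤ N := fun i => Finset.single_le_sum (fun _ _ => Nat.zero_le _)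
    (Finset.mem_univ i)
  let v : Fin n → ℕ → Fin m → ℝ := fun i j => if j < N - K i then 0 else u i (j - (N - K i))
  have hv : ∀ i, state A₀ B₀ 0 (v i) N = Pi.single i 1 := by
    intro i
    have := state_delay A₀ B₀ (u i) (N - K i) (K i)
    rw [Nat.sub_add_cancel (hK i), hu i] at this
    exact this
  let P : Matrix (Fin n) (Fin n) ℝ × Matrix (Fin n) (Fin m) ℝ → Matrix (Fin n) (Fin n) ℝ :=
    fun q => Matrix.of fun j i => state q.1 q.2 0 (v i) N j
  have hP : Continuous P := by
    refine continuous_matrix fun j i => ?_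
    exact (continuous_apply j).comp (continuous_state 0 (v i) N)
  have hP₀ : P (A₀, B₀) = 1 := by
    ext j i
    simp [P, hv, Matrix.one_apply, Pi.single_apply]
  have hdet : ∀ᶠ q in nhds (A₀, B₀), (P q).det ≠ 0 :=
    (hP.matrix_det.continuousAt).eventually_ne (by simp [hP₀])
  filter_upwards [hdet] with q hq x z
  have hunit : IsUnit (P q).det := isUnit_iff_ne_zero.mpr hq
  let c : Fin n → ℝ := (P q)⁻¹ *ᵥ (z - q.1 ^ N *ᵥ x)
  have hc : P q *ᵥ c = z - q.1 ^ N *ᵥ x := by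
    simp only [c, Matrix.mulVec_mulVec, Matrix.mul_nonsing_inv _ hunit, Matrix.one_mulVec]
  refine ⟨N, fun j => ∑ i, c i • v i j, ?_⟩
  have h1 := state_add q.1 q.2 x 0 0 (fun j => ∑ i, c i • v i j) N
  have h2 := state_sum q.1 q.2 Finset.univ c (fun _ => 0) v N
  rw [add_zero, zero_add, state_zero_input] at h1
  simp only [smul_zero, Finset.sum_const_zero] at h2
  have h3 : ∑ i, c i • state q.1 q.2 0 (v i) N = P q *ᵥ c := by
    ext j
    simp [P, Matrix.mulVec, dotProduct, mul_comm]
  rw [h1, h2, h3, hc]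
  abel

lemma isObservable_iff {n m p : ℕ} (A : Matrix (Fin n) (Fin n) ℝ)
    (B : Matrix (Fin n) (Fin m) ℝ) (C : Matrix (Fin p) (Fin n) ℝ) :
    IsObservable A B C ↔ ∀ x : Fin n → ℝ, (∀ k : ℕ, (C * A ^ k) *ᵥ x = 0) → x = 0 := by
  constructor
  · intro h x hx
    refine h x 0 fun u k => ?_
    have h1 := state_add A B x 0 0 u k
    rw [add_zero, zero_add, state_zero_input] at h1
    rw [h1, Matrix.mulVec_add, Matrix.mulVec_mulVec, hx k, zero_add]
  · intro h x z hxz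
    refine sub_eq_zero.mp (h _ fun k => ?_)
    have := hxz 0 k
    rw [state_zero_input, state_zero_input, Matrix.mulVec_mulVec, Matrix.mulVec_mulVec] at this
    rw [Matrix.mulVec_sub, this, sub_self]

lemma isOpen_observable (n m p : ℕ) :
    IsOpen {q : Matrix (Fin n) (Fin n) ℝ × Matrix (Fin n) (Fin m) ℝ × Matrix (Fin p) (Fin n) ℝ |
      IsObservable q.1 q.2.1 q.2.2} := by
  rw [isOpen_iff_mem_nhds]
  rintro ⟨A₀, B₀, C₀⟩ h₀
  replace h₀ := (isObservable_iff _ _ _).mp h₀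
  let V : ℕ →o (Submodule ℝ (Fin n → ℝ))ᵒᵈ :=
    { toFun := fun N => OrderDual.toDual (⨅ k ∈ Set.Iio N, LinearMap.ker (C₀ * A₀ ^ k).mulVecLin)
      monotone' := fun a b hab => OrderDual.toDual_le_toDual.mpr
        (biInf_mono fun k hk => lt_of_lt_of_le hk hab) }
  have hV : ∀ N x, x ∈ OrderDual.ofDual (V N) ↔ ∀ k < N, (C₀ * A₀ ^ k) *ᵥ x = 0 := by
    intro N x
    simp [V, Submodule.mem_iInf]
  obtain ⟨N, hN⟩ := IsArtinian.monotone_stabilizes V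
  have hinj : ∀ x : Fin n → ℝ, (∀ k < N, (C₀ * A₀ ^ k) *ᵥ x = 0) → x = 0 := by
    intro x hx
    refine h₀ x fun k => ?_
    have h1 : x ∈ OrderDual.ofDual (V (N + (k + 1))) := by
      rw [← hN _ (Nat.le_add_right N (k + 1))]
      exact (hV N x).mpr hx
    exact (hV _ x).mp h1 k (by omega)
  let G : Matrix (Fin n) (Fin n) ℝ × Matrix (Fin n) (Fin m) ℝ × Matrix (Fin p) (Fin n) ℝ →
      Matrix (Fin n) (Fin n) ℝ :=
    fun q => ∑ k ∈ Finset.range N, (q.2.2 * q.1 ^ k)ᵀ * (q.2.2 * q.1 ^ k)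
  have hG : Continuous G := by
    refine continuous_finsetSum _ fun k _ => ?_
    have : Continuous fun q : Matrix (Fin n) (Fin n) ℝ × Matrix (Fin n) (Fin m) ℝ ×
        Matrix (Fin p) (Fin n) ℝ => q.2.2 * q.1 ^ k :=
      (continuous_snd.comp continuous_snd).matrix_mul (continuous_fst.pow k)
    exact this.matrix_transpose.matrix_mul this
  have hGx : ∀ q x, x ⬝ᵥ (G q *ᵥ x) =
      ∑ k ∈ Finset.range N, ((q.2.2 * q.1 ^ k) *ᵥ x) ⬝ᵥ ((q.2.2 * q.1 ^ k) *ᵥ x) := by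
    intro q x
    simp only [G, Matrix.sum_mulVec, dotProduct_sum]
    refine Finset.sum_congr rfl fun k _ => ?_
    rw [← Matrix.mulVec_mulVec, Matrix.dotProduct_mulVec, Matrix.vecMul_transpose]
  have hdet₀ : (G (A₀, B₀, C₀)).det ≠ 0 := by
    intro hd
    obtain ⟨x, hx0, hx⟩ := Matrix.exists_mulVec_eq_zero_iff.mpr hd
    refine hx0 (hinj x fun k hk => ?_)
    have h1 := hGx (A₀, B₀, C₀) x
    rw [hx, dotProduct_zero] at h1
    have h2 := (Finset.sum_eq_zero_iff_of_nonneg fun k _ =>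
      Finset.sum_nonneg fun i _ => mul_self_nonneg _).mp h1.symm k (Finset.mem_range.mpr hk)
    exact dotProduct_self_eq_zero.mp h2
  have hdet : ∀ᶠ q in nhds (A₀, B₀, C₀), (G q).det ≠ 0 :=
    (hG.matrix_det.continuousAt).eventually_ne hdet₀
  filter_upwards [hdet] with q hq
  refine (isObservable_iff _ _ _).mpr fun x hx => ?_
  by_contra hx0
  refine hq (Matrix.exists_mulVec_eq_zero_iff.mp ⟨x, hx0, ?_⟩)
  simp only [G, Matrix.sum_mulVec]
  refine Finset.sum_eq_zero fun k _ => ?_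
  rw [← Matrix.mulVec_mulVec, hx k, Matrix.mulVec_zero]

/-- The vector space `Sym(n)` of symmetric real matrices. -/
def symMatrix (n : ℕ) : Submodule ℝ (Matrix (Fin n) (Fin n) ℝ) where
  carrier := {A | A.IsSymm}
  add_mem' ha hb := ha.add hb
  zero_mem' := Matrix.isSymm_zero
  smul_mem' c _ ha := ha.smul c

lemma isOpen_posDef (n : ℕ) :
    IsOpen {A : symMatrix n | (A : Matrix (Fin n) (Fin n) ℝ).PosDef} := by
  rw [isOpen_iff_mem_nhds]
  intro A₀ h₀
  have hcont : Continuous fun q : symMatrix n × (Fin n → ℝ) =>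
      q.2 ⬝ᵥ ((q.1 : Matrix (Fin n) (Fin n) ℝ) *ᵥ q.2) :=
    continuous_snd.dotProduct
      ((continuous_subtype_val.comp continuous_fst).matrix_mulVec continuous_snd)
  have key : ∀ᶠ A : symMatrix n in nhds A₀, ∀ x ∈ Metric.sphere (0 : Fin n → ℝ) 1,
      0 < x ⬝ᵥ ((A : Matrix (Fin n) (Fin n) ℝ) *ᵥ x) := by
    refine (isCompact_sphere (0 : Fin n → ℝ) 1).eventually_forall_of_forall_eventually
      fun x hx => ?_
    refine hcont.continuousAt.eventually_const_lt ?_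
    have hx0 : x ≠ 0 := by
      rintro rfl
      simp at hx
    simpa using h₀.dotProduct_mulVec_pos hx0
  filter_upwards [key] with A hA
  refine Matrix.PosDef.of_dotProduct_mulVec_pos ?_ fun x hx => ?_
  · have := A.2
    change (A : Matrix (Fin n) (Fin n) ℝ).IsSymm at this
    rw [Matrix.IsHermitian, Matrix.conjTranspose_eq_transpose_of_trivial]
    exact this
  · have hn : 0 < ‖x‖ := norm_pos_iff.mpr hx
    have h1 := hA (‖x‖⁻¹ • x) (by simp [norm_smul, hn.ne'])
    rw [Matrix.mulVec_smul, dotProduct_smul, smul_dotProduct, smul_eq_mul, smul_eq_mul] at h1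
    have h2 : 0 < ‖x‖⁻¹ := inv_pos.mpr hn
    simpa using pos_of_mul_pos_right (pos_of_mul_pos_right h1 h2.le) h2.le

/-! ### The manifold `N` and the action of `O(n)` -/

/-- The vector space `Sym(n) × ℝ^{n×m} × ℝ^{p×n}`. -/
def SymTriple (n m p : ℕ) : Type :=
  symMatrix n × Matrix (Fin n) (Fin m) ℝ × Matrix (Fin p) (Fin n) ℝ

namespace SymTriple

/-- The component `A` of `(A, B, C)`. -/
def A {n m p : ℕ} (Θ : SymTriple n m p) : Matrix (Fin n) (Fin n) ℝ := Θ.1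

/-- The component `B` of `(A, B, C)`. -/
def B {n m p : ℕ} (Θ : SymTriple n m p) : Matrix (Fin n) (Fin m) ℝ := Θ.2.1

/-- The component `C` of `(A, B, C)`. -/
def C {n m p : ℕ} (Θ : SymTriple n m p) : Matrix (Fin p) (Fin n) ℝ := Θ.2.2

section Norm

-- The entrywise maximum norm on matrices. All norms on the finite-dimensional space `SymTriple`
-- induce the same topology and the same smooth structure.
attribute [local instance] Matrix.normedAddCommGroup Matrix.normedSpace

noncomputable instance instNormedAddCommGroup (n m p : ℕ) : NormedAddCommGroup (SymTriple n m p) :=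
  inferInstanceAs (NormedAddCommGroup
    (symMatrix n × Matrix (Fin n) (Fin m) ℝ × Matrix (Fin p) (Fin n) ℝ))

noncomputable instance instNormedSpace (n m p : ℕ) : NormedSpace ℝ (SymTriple n m p) :=
  inferInstanceAs (NormedSpace ℝ
    (symMatrix n × Matrix (Fin n) (Fin m) ℝ × Matrix (Fin p) (Fin n) ℝ))

end Norm

lemma continuous_fst (n m p : ℕ) : Continuous fun Θ : SymTriple n m p => (Θ.1 : symMatrix n) :=
  _root_.continuous_fst (X := symMatrix n)
    (Y := Matrix (Fin n) (Fin m) ℝ × Matrix (Fin p) (Fin n) ℝ)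

lemma continuous_A (n m p : ℕ) : Continuous fun Θ : SymTriple n m p => Θ.A :=
  continuous_subtype_val.comp (continuous_fst n m p)

lemma continuous_B (n m p : ℕ) : Continuous fun Θ : SymTriple n m p => Θ.B :=
  (_root_.continuous_fst.comp _root_.continuous_snd :
    Continuous fun Θ : symMatrix n × Matrix (Fin n) (Fin m) ℝ × Matrix (Fin p) (Fin n) ℝ => Θ.2.1)

lemma continuous_C (n m p : ℕ) : Continuous fun Θ : SymTriple n m p => Θ.C :=
  (_root_.continuous_snd.comp _root_.continuous_snd :
    Continuous fun Θ : symMatrix n × Matrix (Fin n) (Fin m) ℝ × Matrix (Fin p) (Fin n) ℝ => Θ.2.2)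

end SymTriple

/-- The set `N` of controllable and observable triples `(A, B, C)` with `A` symmetric positive
definite, as an open subset of `Sym(n) × ℝ^{n×m} × ℝ^{p×n}`; it carries the smooth structure of
an open submanifold of this vector space. -/
def N (n m p : ℕ) : TopologicalSpace.Opens (SymTriple n m p) where
  carrier := {Θ | Θ.A.PosDef ∧ IsControllable Θ.A Θ.B ∧ IsObservable Θ.A Θ.B Θ.C}
  is_open' :=
    ((isOpen_posDef n).preimage (SymTriple.continuous_fst n m p)).inter
      (((isOpen_controllable n m).preimage
        ((SymTriple.continuous_A n m p).prodMk (SymTriple.continuous_B n m p))).inter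
        ((isOpen_observable n m p).preimage ((SymTriple.continuous_A n m p).prodMk
          ((SymTriple.continuous_B n m p).prodMk (SymTriple.continuous_C n m p)))))

/-- The orthogonal group `O(n)`. -/
abbrev O (n : ℕ) : Type := Matrix.orthogonalGroup (Fin n) ℝ

lemma O.mul_transpose {n : ℕ} (U : O n) :
    (U : Matrix (Fin n) (Fin n) ℝ) * (U : Matrix (Fin n) (Fin n) ℝ)ᵀ = 1 :=
  (Matrix.mem_orthogonalGroup_iff (Fin n) ℝ).mp U.2

/-- The triple `U ∘ Θ = (Uᵀ A U, Uᵀ B, C U)`. -/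
def act {n m p : ℕ} (U : O n) (Θ : N n m p) : N n m p :=
  ⟨(⟨(U : Matrix (Fin n) (Fin n) ℝ)ᵀ * Θ.1.A * (U : Matrix (Fin n) (Fin n) ℝ), by
      have h : (Θ.1.A)ᵀ = Θ.1.A := Θ.1.1.2
      change ((U : Matrix (Fin n) (Fin n) ℝ)ᵀ * Θ.1.A * (U : Matrix (Fin n) (Fin n) ℝ))ᵀ = _
      simp [Matrix.transpose_mul, Matrix.mul_assoc, h]⟩,
    (U : Matrix (Fin n) (Fin n) ℝ)ᵀ * Θ.1.B,
    Θ.1.C * (U : Matrix (Fin n) (Fin n) ℝ)),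
   by
    have h := O.mul_transpose U
    refine ⟨?_, Θ.2.2.1.conj h, Θ.2.2.2.conj h⟩
    have hinj : Function.Injective (U : Matrix (Fin n) (Fin n) ℝ).mulVec := by
      intro x y hxy
      have := congrArg ((U : Matrix (Fin n) (Fin n) ℝ)ᵀ *ᵥ ·) hxy
      simpa [Matrix.mulVec_mulVec, mul_eq_one_comm.mp h] using this
    have := Θ.2.1.conjTranspose_mul_mul_same hinj
    rwa [Matrix.conjTranspose_eq_transpose_of_trivial] at this⟩

/-- The action `U ∘ Θ` of `O(n)` on `N`. Since `U ∘ (V ∘ Θ) = (V U) ∘ Θ`, it is a right action of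
`O(n)`, that is, an action of the opposite group. -/
instance instOAction (n m p : ℕ) : MulAction (O n)ᵐᵒᵖ (N n m p) where
  smul g Θ := act g.unop Θ
  one_smul Θ := by
    change act 1 Θ = Θ
    refine Subtype.ext (Prod.ext (Subtype.ext ?_) (Prod.ext ?_ ?_)) <;>
      simp [act, SymTriple.A, SymTriple.B, SymTriple.C]
  mul_smul g h Θ := by
    change act (h.unop * g.unop) Θ = act g.unop (act h.unop Θ)
    refine Subtype.ext (Prod.ext (Subtype.ext ?_) (Prod.ext ?_ ?_)) <;>
      simp [act, SymTriple.A, SymTriple.B, SymTriple.C, Matrix.mul_assoc]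

/-- The quotient set `N / O(n)`, with the quotient topology. -/
abbrev NQuot (n m p : ℕ) : Type := MulAction.orbitRel.Quotient (O n)ᵐᵒᵖ (N n m p)

/-- The canonical projection `π : N → N / O(n)`, `π Θ = [Θ]`. -/
def proj {n m p : ℕ} (Θ : N n m p) : NQuot n m p := Quotient.mk _ Θ

/-- The charts `cs` (with values in `ℝ^d`) form a smooth atlas on `N / O(n)`, for which the
canonical projection is a smooth submersion. -/
structure IsQuotientManifold {n m p d : ℕ}
    (cs : ChartedSpace (EuclideanSpace ℝ (Fin d)) (NQuot n m p)) : Prop where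
  isManifold : IsManifold (𝓡 d) ∞ (NQuot n m p)
  isSubmersion : Manifold.IsSubmersion 𝓘(ℝ, SymTriple n m p) (𝓡 d) ∞
    (proj : N n m p → NQuot n m p)

end SymSys

/-! Freeness comes from controllability: a state transformation that fixes `A` and `B` fixes every
state reachable from `0`, hence every state (`IsControllable.eq_one_of_conj`). Infinitesimally, a
matrix that commutes with `A` and annihilates `B` kills all reachable states, so it is zero
(`IsControllable.eq_zero_of_commute`). Hence the differential of each orbit map is injective on
skew-symmetric matrices. Compactness of `O(n)` makes the action proper and the quotient Hausdorff.

The core is a slice theorem, `exists_orbitChart`. At `Θ₀`, choose a complement `S` of the tangent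
space of the orbit and send `(s, X)`, with `s` in `S` and `X` skew-symmetric, to `U ∘ (Θ₀ + s)`,
where `U` is the Cayley transform of `X`. The differential at `0` is bijective, so this is a local
diffeomorphism. By properness and freeness, a group element that moves a point near `Θ₀` to a point
near `Θ₀` is close to `1`, hence the Cayley transform of a small `X`. Local injectivity then shows
that two nearby slice points on one orbit coincide. So in the resulting chart the coordinate `s`
labels the orbits.

Forgetting `X` gives charts of the orbit space, in which the projection is a linear projection;
fixing `s = 0` gives charts of the orbit through `Θ₀`. Uniqueness holds because a submersion has
smooth local sections: a map out of its target is smooth once its pullback is, so the identity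
between two such structures is a diffeomorphism. -/

section Preliminaries

open Set Filter Topology

/-- Two maps which are continuous and open along an open set `s` and have the same fibers there
induce an open partial homeomorphism between their targets. -/
noncomputable def OpenPartialHomeomorph.ofSameFibers {X Q Y : Type*} [TopologicalSpace X]
    [TopologicalSpace Q] [TopologicalSpace Y] [Nonempty X] (q : X → Q) (p : X → Y) (s : Set X)
    (hs : IsOpen s) (hq : ∀ x ∈ s, map q (𝓝 x) = 𝓝 (q x)) (hp : ∀ x ∈ s, map p (𝓝 x) = 𝓝 (p x))
    (h : ∀ x ∈ s, ∀ y ∈ s, q x = q y ↔ p x = p y) : OpenPartialHomeomorph Q Y :=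
  -- `invFunOn` picks an arbitrary preimage in `s`; equality of fibers makes the value of the other
  -- map independent of the choice.
  have hpq : ∀ x ∈ s, p (Function.invFunOn q s (q x)) = p x := fun x hx =>
    (h _ (Function.invFunOn_mem ⟨x, hx, rfl⟩) _ hx).1 (Function.invFunOn_eq ⟨x, hx, rfl⟩)
  have hqp : ∀ x ∈ s, q (Function.invFunOn p s (p x)) = q x := fun x hx =>
    (h _ (Function.invFunOn_mem ⟨x, hx, rfl⟩) _ hx).2 (Function.invFunOn_eq ⟨x, hx, rfl⟩)
  { toFun := fun y => p (Function.invFunOn q s y)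
    invFun := fun y => q (Function.invFunOn p s y)
    source := q '' s
    target := p '' s
    map_source' := by
      rintro _ ⟨x, hx, rfl⟩
      exact ⟨x, hx, (hpq x hx).symm⟩
    map_target' := by
      rintro _ ⟨x, hx, rfl⟩
      exact ⟨x, hx, (hqp x hx).symm⟩
    left_inv' := by
      rintro _ ⟨x, hx, rfl⟩
      rw [hpq x hx, hqp x hx]
    right_inv' := by
      rintro _ ⟨x, hx, rfl⟩
      rw [hqp x hx, hpq x hx]
    open_source := by
      rw [isOpen_iff_mem_nhds]
      rintro _ ⟨x, hx, rfl⟩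
      rw [← hq x hx]
      exact image_mem_map (hs.mem_nhds hx)
    open_target := by
      rw [isOpen_iff_mem_nhds]
      rintro _ ⟨x, hx, rfl⟩
      rw [← hp x hx]
      exact image_mem_map (hs.mem_nhds hx)
    continuousOn_toFun := by
      rintro _ ⟨x, hx, rfl⟩
      refine ContinuousAt.continuousWithinAt ?_
      -- The neighborhoods of `q x` are the images of those of `x`, so continuity can be tested
      -- after composing with `q`, where the map becomes `p`.
      rw [ContinuousAt, hpq x hx, ← hq x hx, tendsto_map'_iff, ← hp x hx]
      refine tendsto_map.congr' ?_
      filter_upwards [hs.mem_nhds hx] with y hy using (hpq y hy).symm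
    continuousOn_invFun := by
      rintro _ ⟨x, hx, rfl⟩
      refine ContinuousAt.continuousWithinAt ?_
      rw [ContinuousAt, hqp x hx, ← hp x hx, tendsto_map'_iff, ← hq x hx]
      refine tendsto_map.congr' ?_
      filter_upwards [hs.mem_nhds hx] with y hy using (hqp y hy).symm }

/-! ### Orbit charts and the smooth structure of an orbit space -/

section OrbitChart

variable {E F₁ F₂ : Type*} [NormedAddCommGroup E] [NormedSpace ℝ E] [NormedAddCommGroup F₁]
  [NormedSpace ℝ F₁] [NormedAddCommGroup F₂] [NormedSpace ℝ F₂]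
  {M : Type*} [TopologicalSpace M] [ChartedSpace E M]
  {G : Type*} [Group G] [MulAction G M]

/-- A smooth chart of `M` whose domain meets each orbit of `G` in a slice `F₂`. -/
structure OrbitChart (G : Type*) [Group G] [MulAction G M] (ℓ : E ≃L[ℝ] F₁ × F₂)
    (φ : OpenPartialHomeomorph M E) : Prop where
  mem_maximalAtlas : φ ∈ IsManifold.maximalAtlas 𝓘(ℝ, E) ∞ M
  orbit_iff : ∀ y ∈ φ.source, ∀ z ∈ φ.source,
    (Quotient.mk (MulAction.orbitRel G M) y = Quotient.mk (MulAction.orbitRel G M) z ↔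
      (ℓ (φ y)).1 = (ℓ (φ z)).1)

namespace OrbitChart

variable {ℓ : E ≃L[ℝ] F₁ × F₂} {φ φ' : OpenPartialHomeomorph M E}

lemma map_quotient_nhds [ContinuousConstSMul G M] (x : M) :
    map (Quotient.mk (MulAction.orbitRel G M)) (𝓝 x) =
      𝓝 (Quotient.mk (MulAction.orbitRel G M) x) :=
  le_antisymm continuous_quotient_mk'.continuousAt
    ((isOpenMap_quotient_mk'_mul (Γ := G) (T := M)).nhds_le x)

omit [ChartedSpace E M] in
lemma map_fst_nhds (ℓ : E ≃L[ℝ] F₁ × F₂) {x : M} (hx : x ∈ φ.source) :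
    map (fun y => (ℓ (φ y)).1) (𝓝 x) = 𝓝 (ℓ (φ x)).1 := by
  have h1 := φ.map_nhds_eq hx
  have h2 := ℓ.toHomeomorph.map_nhds_eq (φ x)
  have h3 : map Prod.fst (𝓝 (ℓ (φ x))) = 𝓝 (ℓ (φ x)).1 := _root_.map_fst_nhds _
  change map (Prod.fst ∘ ℓ.toHomeomorph ∘ φ) (𝓝 x) = _
  rw [← Filter.map_map, ← Filter.map_map, h1, h2]
  exact h3

variable [ContinuousConstSMul G M] [Nonempty M]

/-- The chart on the orbit space induced by an orbit chart. -/
noncomputable def quotientChart (h : OrbitChart G ℓ φ) :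
    OpenPartialHomeomorph (MulAction.orbitRel.Quotient G M) F₁ :=
  OpenPartialHomeomorph.ofSameFibers (Quotient.mk (MulAction.orbitRel G M))
    (fun y => (ℓ (φ y)).1) φ.source φ.open_source (fun x _ => map_quotient_nhds x)
    (fun _ hx => map_fst_nhds ℓ hx) h.orbit_iff

lemma quotientChart_mk (h : OrbitChart G ℓ φ) {x : M} (hx : x ∈ φ.source) :
    h.quotientChart (Quotient.mk _ x) = (ℓ (φ x)).1 :=
  (h.orbit_iff _ (Function.invFunOn_mem ⟨x, hx, rfl⟩) _ hx).1 (Function.invFunOn_eq ⟨x, hx, rfl⟩)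

lemma quotientChart_symm_fst (h : OrbitChart G ℓ φ) {x : M} (hx : x ∈ φ.source) :
    h.quotientChart.symm (ℓ (φ x)).1 = Quotient.mk _ x := by
  rw [← h.quotientChart_mk hx]
  exact h.quotientChart.left_inv ⟨x, hx, rfl⟩

/-- Points of the two charts over the same class differ by some `g` in `G`. Near that class the
transition map is a slice section of `φ`, followed by this fixed `g`, by `φ'` and by the first
coordinate; each factor is smooth. -/
lemma contDiffOn_quotientChart_trans [IsManifold 𝓘(ℝ, E) ∞ M]
    (hG : ∀ g : G, ContMDiff 𝓘(ℝ, E) 𝓘(ℝ, E) ∞ fun x : M => g • x)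
    (h : OrbitChart G ℓ φ) (h' : OrbitChart G ℓ φ') :
    ContDiffOn ℝ ∞ (h.quotientChart.symm.trans h'.quotientChart)
      (h.quotientChart.symm.trans h'.quotientChart).source := by
  intro v hv
  refine ContDiffAt.contDiffWithinAt ?_
  obtain ⟨hv1, hv2⟩ := hv
  obtain ⟨x, hx, rfl⟩ : v ∈ (fun y => (ℓ (φ y)).1) '' φ.source := hv1
  change h.quotientChart.symm (ℓ (φ x)).1 ∈ h'.quotientChart.source at hv2
  rw [h.quotientChart_symm_fst hx] at hv2
  obtain ⟨z, hz, hzx⟩ := hv2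
  obtain ⟨g, rfl⟩ : ∃ g : G, g • x = z := Quotient.exact hzx
  -- the transition map near `v`
  let τ : F₁ → M := fun v' => φ.symm (ℓ.symm (v', (ℓ (φ x)).2))
  have hτx : τ (ℓ (φ x)).1 = x := by simp [τ, hx]
  have hτ : ContMDiffAt 𝓘(ℝ, F₁) 𝓘(ℝ, E) ∞ τ (ℓ (φ x)).1 := by
    refine ContMDiffAt.comp (g := φ.symm) (I' := 𝓘(ℝ, E)) _ ?_ ?_
    · exact contMDiffAt_symm_of_mem_maximalAtlas h.mem_maximalAtlas (by simp [hx])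
    · exact (ℓ.symm.contDiff.comp (contDiff_id.prodMk contDiff_const)).contMDiff.contMDiffAt
  have hgτ : ContMDiffAt 𝓘(ℝ, F₁) 𝓘(ℝ, E) ∞ (fun v' => φ' (g • τ v')) (ℓ (φ x)).1 := by
    refine ContMDiffAt.comp (g := φ') (I' := 𝓘(ℝ, E)) _ ?_ ((hG g).contMDiffAt.comp _ hτ)
    refine contMDiffAt_of_mem_maximalAtlas h'.mem_maximalAtlas ?_
    rwa [hτx]
  have hfin : ContDiffAt ℝ ∞ (fun v' => (ℓ (φ' (g • τ v'))).1) (ℓ (φ x)).1 :=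
    contDiff_fst.contDiffAt.comp _ (ℓ.contDiff.contDiffAt.comp _ hgτ.contDiffAt)
  refine hfin.congr_of_eventuallyEq ?_
  have e1 : ∀ᶠ v' in 𝓝 (ℓ (φ x)).1, τ v' ∈ φ.source ∧ (ℓ (φ (τ v'))).1 = v' := by
    have hc : ContinuousAt (fun v' => ℓ.symm (v', (ℓ (φ x)).2)) (ℓ (φ x)).1 := by fun_prop
    filter_upwards [hc.preimage_mem_nhds (φ.open_target.mem_nhds (by simp [hx]))] with v' hv'
    exact ⟨φ.map_target hv', by simp [τ, φ.right_inv hv']⟩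
  have e2 : ∀ᶠ v' in 𝓝 (ℓ (φ x)).1, g • τ v' ∈ φ'.source := by
    refine ((continuous_const_smul g).continuousAt.comp hτ.continuousAt).preimage_mem_nhds
      (φ'.open_source.mem_nhds ?_)
    simpa [hτx] using hz
  filter_upwards [e1, e2] with v' h1 h2
  have h3 := h.quotientChart_symm_fst h1.1
  rw [h1.2] at h3
  change h'.quotientChart (h.quotientChart.symm v') = _
  rw [h3, ← h'.quotientChart_mk h2]
  congr 1
  exact (Quotient.sound (⟨g, rfl⟩ : MulAction.orbitRel G M _ _)).symm

end OrbitChart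

variable [IsManifold 𝓘(ℝ, E) ∞ M] {ℓ : E ≃L[ℝ] F₁ × F₂}

/-- If a group acts by diffeomorphisms and every point has an orbit chart, the orbit space is a
manifold, and the projection onto it is a submersion. -/
theorem exists_chartedSpace_orbitQuotient
    (hG : ∀ g : G, ContMDiff 𝓘(ℝ, E) 𝓘(ℝ, E) ∞ fun x : M => g • x)
    (hM : ∀ x : M, ∃ φ : OpenPartialHomeomorph M E, x ∈ φ.source ∧ OrbitChart G ℓ φ) :
    ∃ _ : ChartedSpace F₁ (MulAction.orbitRel.Quotient G M),
      IsManifold 𝓘(ℝ, F₁) ∞ (MulAction.orbitRel.Quotient G M) ∧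
      Manifold.IsSubmersion 𝓘(ℝ, E) 𝓘(ℝ, F₁) ∞
        (fun x : M => (Quotient.mk _ x : MulAction.orbitRel.Quotient G M)) := by
  have : ContinuousConstSMul G M := ⟨fun g => (hG g).continuous⟩
  have hne : ∀ y : MulAction.orbitRel.Quotient G M, Nonempty M := fun y => ⟨y.out⟩
  choose φ hxφ hφ using hM
  -- `M` may be empty, while `quotientChart` needs a point of `M` for its default value; any class
  -- supplies one.
  let cs : ChartedSpace F₁ (MulAction.orbitRel.Quotient G M) :=
    { atlas := {e | ∃ (_ : Nonempty M) (x : M), e = (hφ x).quotientChart}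
      chartAt := fun y => haveI := hne y; (hφ y.out).quotientChart
      mem_chart_source := fun y => ⟨y.out, hxφ _, y.out_eq⟩
      chart_mem_atlas := fun y => ⟨hne y, y.out, rfl⟩ }
  have hmf : IsManifold 𝓘(ℝ, F₁) ∞ (MulAction.orbitRel.Quotient G M) := by
    refine isManifold_of_contDiffOn _ _ _ ?_
    rintro _ _ ⟨_, x, rfl⟩ ⟨_, x', rfl⟩
    simpa using (hφ x).contDiffOn_quotientChart_trans hG (hφ x')
  refine ⟨cs, hmf, Manifold.IsSubmersionOfComplement.isSubmersion (F := F₂) fun x => ?_⟩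
  have : Nonempty M := ⟨x⟩
  -- In these charts the projection is `Prod.fst` after `ℓ`, the normal form of a submersion.
  refine Manifold.IsSubmersionAtOfComplement.mk_of_continuousAt
    continuous_quotient_mk'.continuousAt ℓ (φ x) (hφ x).quotientChart (hxφ x) ⟨x, hxφ x, rfl⟩
    (hφ x).mem_maximalAtlas (IsManifold.subset_maximalAtlas ⟨this, x, rfl⟩) ?_
  intro u hu
  have hu' : u ∈ (φ x).target := by simpa using hu
  have := (hφ x).quotientChart_mk ((φ x).map_target hu')
  rw [(φ x).right_inv hu'] at this
  simpa using this

end OrbitChart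

/-! ### Orbits as embedded submanifolds -/

section OrbitFiber

variable {E F₁ F₂ : Type*} [NormedAddCommGroup E] [NormedSpace ℝ E] [NormedAddCommGroup F₁]
  [NormedSpace ℝ F₁] [NormedAddCommGroup F₂] [NormedSpace ℝ F₂]
  {M : Type*} [TopologicalSpace M] [ChartedSpace E M]
  {G : Type*} [Group G] [MulAction G M]

namespace OrbitChart

variable {ℓ : E ≃L[ℝ] F₁ × F₂} {φ φ' : OpenPartialHomeomorph M E}
  {b : MulAction.orbitRel.Quotient G M}

/-- The first coordinate is constant on the part of an orbit inside the chart, and the centering at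
`x` makes the constant `0`. -/
lemma fst_eq_zero (h : OrbitChart G ℓ φ) {x y : M}
    (hx : Quotient.mk (MulAction.orbitRel G M) x = b) (hxφ : x ∈ φ.source)
    (hx0 : (ℓ (φ x)).1 = 0) (hy : Quotient.mk (MulAction.orbitRel G M) y = b)
    (hyφ : y ∈ φ.source) : (ℓ (φ y)).1 = 0 := by
  rw [← hx0]
  exact (h.orbit_iff _ hyφ _ hxφ).1 (hy.trans hx.symm)

lemma mk_symm_eq (h : OrbitChart G ℓ φ) {x : M}
    (hx : Quotient.mk (MulAction.orbitRel G M) x = b) (hxφ : x ∈ φ.source)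
    (hx0 : (ℓ (φ x)).1 = 0) {w : F₂} (hw : ℓ.symm (0, w) ∈ φ.target) :
    Quotient.mk (MulAction.orbitRel G M) (φ.symm (ℓ.symm (0, w))) = b := by
  rw [← hx]
  exact (h.orbit_iff _ (φ.map_target hw) _ hxφ).2 (by simp [φ.right_inv hw, hx0])

open Classical in
/-- The chart on an orbit induced by an orbit chart centered on this orbit. -/
noncomputable def fiberChart (h : OrbitChart G ℓ φ) (x : M)
    (hx : Quotient.mk (MulAction.orbitRel G M) x = b) (hxφ : x ∈ φ.source)
    (hx0 : (ℓ (φ x)).1 = 0) :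
    OpenPartialHomeomorph (Quotient.mk (MulAction.orbitRel G M) ⁻¹' {b}) F₂ where
  toFun y := (ℓ (φ y.1)).2
  -- Off the target `φ.symm` need not land in the orbit, so the base point `x` serves as default
  -- value.
  invFun w := if hw : ℓ.symm (0, w) ∈ φ.target then ⟨φ.symm (ℓ.symm (0, w)),
    h.mk_symm_eq hx hxφ hx0 hw⟩ else ⟨x, hx⟩
  source := {y | y.1 ∈ φ.source}
  target := {w | ℓ.symm (0, w) ∈ φ.target}
  map_source' := by
    intro y hy
    have h1 := h.fst_eq_zero hx hxφ hx0 y.2 hy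
    have h2 : ((0 : F₁), (ℓ (φ y.1)).2) = ℓ (φ y.1) := Prod.ext h1.symm rfl
    simpa [h2] using φ.map_source hy
  map_target' := by
    intro w hw
    simp only [mem_ofPred_eq] at hw
    simp [hw]
  left_inv' := by
    intro y hy
    have h1 := h.fst_eq_zero hx hxφ hx0 y.2 hy
    have h2 : ((0 : F₁), (ℓ (φ y.1)).2) = ℓ (φ y.1) := Prod.ext h1.symm rfl
    simp only [mem_ofPred_eq] at hy
    simp [h2, hy]
  right_inv' := by
    intro w hw
    simp only [mem_ofPred_eq] at hw
    simp [hw]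
  open_source := φ.open_source.preimage continuous_subtype_val
  open_target := φ.open_target.preimage (by fun_prop)
  continuousOn_toFun := by
    refine (continuous_snd.comp ℓ.continuous).comp_continuousOn ?_
    exact φ.continuousOn.comp continuous_subtype_val.continuousOn fun y hy => hy
  continuousOn_invFun := by
    rw [IsInducing.subtypeVal.continuousOn_iff]
    have h1 : ContinuousOn (fun w : F₂ => φ.symm (ℓ.symm (0, w)))
        {w | ℓ.symm (0, w) ∈ φ.target} :=
      φ.continuousOn_symm.comp (by fun_prop) fun w hw => hw
    refine h1.congr fun w hw => ?_
    simp only [mem_ofPred_eq] at hw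
    simp [hw]

lemma coe_fiberChart_symm (h : OrbitChart G ℓ φ) {x : M}
    (hx : Quotient.mk (MulAction.orbitRel G M) x = b) (hxφ : x ∈ φ.source)
    (hx0 : (ℓ (φ x)).1 = 0) {w : F₂} (hw : w ∈ (h.fiberChart x hx hxφ hx0).target) :
    ((h.fiberChart x hx hxφ hx0).symm w : M) = φ.symm (ℓ.symm (0, w)) := by
  have hw' : ℓ.symm (0, w) ∈ φ.target := hw
  simp [fiberChart, hw']

/-- This is the transition map of `M` from `φ` to `φ'`, restricted to `{0} × F₂` and projected to
`F₂`. -/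
lemma contDiffOn_fiberChart_trans (h : OrbitChart G ℓ φ) (h' : OrbitChart G ℓ φ') {x x' : M}
    (hx : Quotient.mk (MulAction.orbitRel G M) x = b) (hxφ : x ∈ φ.source)
    (hx0 : (ℓ (φ x)).1 = 0) (hx' : Quotient.mk (MulAction.orbitRel G M) x' = b)
    (hxφ' : x' ∈ φ'.source) (hx0' : (ℓ (φ' x')).1 = 0) [IsManifold 𝓘(ℝ, E) ∞ M] :
    ContDiffOn ℝ ∞ ((h.fiberChart x hx hxφ hx0).symm.trans (h'.fiberChart x' hx' hxφ' hx0'))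
      ((h.fiberChart x hx hxφ hx0).symm.trans (h'.fiberChart x' hx' hxφ' hx0')).source := by
  have key : ContDiffOn ℝ ∞ (fun w : F₂ => (ℓ (φ' (φ.symm (ℓ.symm (0, w))))).2)
      ((h.fiberChart x hx hxφ hx0).symm.trans (h'.fiberChart x' hx' hxφ' hx0')).source := by
    rintro w ⟨hw1, hw2⟩
    refine ContDiffAt.contDiffWithinAt ?_
    have hw3 : ((h.fiberChart x hx hxφ hx0).symm w : M) ∈ φ'.source := hw2
    rw [h.coe_fiberChart_symm hx hxφ hx0 hw1] at hw3
    have hτ : ContMDiffAt 𝓘(ℝ, F₂) 𝓘(ℝ, E) ∞ (fun w' => φ.symm (ℓ.symm (0, w'))) w := by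
      refine ContMDiffAt.comp (g := φ.symm) (I' := 𝓘(ℝ, E)) _ ?_ ?_
      · exact contMDiffAt_symm_of_mem_maximalAtlas h.mem_maximalAtlas hw1
      · exact (ℓ.symm.contDiff.comp (contDiff_const.prodMk contDiff_id)).contMDiff.contMDiffAt
    have hgτ := ContMDiffAt.comp (g := φ') (I' := 𝓘(ℝ, E))
      (f := fun w' => φ.symm (ℓ.symm (0, w'))) w
      (contMDiffAt_of_mem_maximalAtlas h'.mem_maximalAtlas hw3) hτ
    exact contDiff_snd.contDiffAt.comp _ (ℓ.contDiff.contDiffAt.comp _ hgτ.contDiffAt)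
  refine key.congr fun w hw => ?_
  have := h.coe_fiberChart_symm hx hxφ hx0 hw.1
  change (ℓ (φ' ((h.fiberChart x hx hxφ hx0).symm w : M))).2 = _
  rw [this]

end OrbitChart

variable [IsManifold 𝓘(ℝ, E) ∞ M] {ℓ : E ≃L[ℝ] F₁ × F₂}

/-- If every point has a centered orbit chart, orbits are embedded submanifolds. -/
theorem exists_chartedSpace_orbitFiber
    (hM : ∀ x : M, ∃ φ : OpenPartialHomeomorph M E, x ∈ φ.source ∧ (ℓ (φ x)).1 = 0 ∧
      OrbitChart G ℓ φ) (b : MulAction.orbitRel.Quotient G M) :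
    ∃ _ : ChartedSpace F₂ (Quotient.mk (MulAction.orbitRel G M) ⁻¹' {b}),
      IsManifold 𝓘(ℝ, F₂) ∞ (Quotient.mk (MulAction.orbitRel G M) ⁻¹' {b}) ∧
      Manifold.IsSmoothEmbedding 𝓘(ℝ, F₂) 𝓘(ℝ, E) ∞
        (Subtype.val : (Quotient.mk (MulAction.orbitRel G M) ⁻¹' {b}) → M) := by
  choose φ hxφ hx0 hφ using hM
  let c := fun z : (Quotient.mk (MulAction.orbitRel G M) ⁻¹' {b}) =>
    (hφ z).fiberChart z.1 z.2 (hxφ z) (hx0 z)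
  let cs : ChartedSpace F₂ (Quotient.mk (MulAction.orbitRel G M) ⁻¹' {b}) :=
    { atlas := range c
      chartAt := c
      mem_chart_source := fun z => hxφ z
      chart_mem_atlas := fun z => ⟨z, rfl⟩ }
  have hmf : IsManifold 𝓘(ℝ, F₂) ∞ (Quotient.mk (MulAction.orbitRel G M) ⁻¹' {b}) := by
    refine isManifold_of_contDiffOn _ _ _ ?_
    rintro _ _ ⟨z, rfl⟩ ⟨z', rfl⟩
    simpa using (hφ z).contDiffOn_fiberChart_trans (hφ z') z.2 (hxφ z) (hx0 z) z'.2 (hxφ z')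
      (hx0 z')
  refine ⟨cs, hmf, Manifold.IsImmersionOfComplement.isImmersion (F := F₁) fun z => ?_,
    IsEmbedding.subtypeVal⟩
  -- In charts the inclusion is `w ↦ ℓ.symm (0, w)`. The normal form of an immersion is `w ↦ (w,
  -- 0)`, hence the swap of factors.
  refine Manifold.IsImmersionAtOfComplement.mk_of_continuousAt
    continuous_subtype_val.continuousAt ((ContinuousLinearEquiv.prodComm ℝ F₂ F₁).trans ℓ.symm)
    (c z) (φ z) (hxφ z) (hxφ z) (IsManifold.subset_maximalAtlas ⟨z, rfl⟩)
    (hφ z).mem_maximalAtlas ?_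
  intro w hw
  have hw' : w ∈ (c z).target := by simpa using hw
  have h1 := (hφ z).coe_fiberChart_symm z.2 (hxφ z) (hx0 z) hw'
  change φ z ((c z).symm w : M) = ℓ.symm (0, w)
  rw [h1, (φ z).right_inv hw']

end OrbitFiber

/-! ### Uniqueness of a smooth structure under a submersion -/

section SubmersionUnique

variable {E F : Type*} [NormedAddCommGroup E] [NormedSpace ℝ E] [NormedAddCommGroup F]
  [NormedSpace ℝ F] {M Q : Type*} [TopologicalSpace M] [ChartedSpace E M] [TopologicalSpace Q]

/-- A submersion has a smooth local section through every point. -/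
lemma Manifold.IsSubmersionAt.exists_section [ChartedSpace F Q] {f : M → Q} {x : M}
    (hf : Manifold.IsSubmersionAt 𝓘(ℝ, E) 𝓘(ℝ, F) ∞ f x) :
    ∃ σ : Q → M, ContMDiffAt 𝓘(ℝ, F) 𝓘(ℝ, E) ∞ σ (f x) ∧ σ (f x) = x ∧
      ∀ᶠ y in 𝓝 (f x), f (σ y) = y := by
  set φ := hf.domChart
  set ψ := hf.codChart
  set e := hf.equiv
  have hxφ : x ∈ φ.source := hf.mem_domChart_source
  have hxψ : f x ∈ ψ.source := hf.mem_codChart_source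
  have hw : ∀ u ∈ φ.target, ψ (f (φ.symm u)) = (e u).1 := fun u hu => by
    have hu' : u ∈ (φ.extend 𝓘(ℝ, E)).target := by simpa using hu
    simpa using hf.writtenInCharts hu'
  have hψx : ψ (f x) = (e (φ x)).1 := by
    simpa [hxφ] using hw (φ x) (φ.map_source hxφ)
  -- The section freezes the complementary coordinate at its value at `x`.
  let τ : Q → E := fun y => e.symm (ψ y, (e (φ x)).2)
  have hτx : τ (f x) = φ x := by simp [τ, hψx]
  have hτ : ContMDiffAt 𝓘(ℝ, F) 𝓘(ℝ, E) ∞ τ (f x) := by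
    refine ContMDiffAt.comp (I' := 𝓘(ℝ, F)) (g := fun v => e.symm (v, (e (φ x)).2)) _ ?_
      (contMDiffAt_of_mem_maximalAtlas hf.codChart_mem_maximalAtlas hxψ)
    exact (e.symm.contDiff.comp (contDiff_id.prodMk contDiff_const)).contMDiff.contMDiffAt
  refine ⟨fun y => φ.symm (τ y), ?_, by simp [hτx, hxφ], ?_⟩
  · refine ContMDiffAt.comp (I' := 𝓘(ℝ, E)) (g := φ.symm) _ ?_ hτ
    exact contMDiffAt_symm_of_mem_maximalAtlas hf.domChart_mem_maximalAtlas (by simp [hτx, hxφ])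
  · filter_upwards [hτ.continuousAt.preimage_mem_nhds (φ.open_target.mem_nhds
      (by simp [hτx, hxφ])), ψ.open_source.mem_nhds hxψ] with y hy hyψ
    refine ψ.injOn ?_ hyψ ?_
    · exact hf.source_subset_preimage_source (φ.map_target hy)
    · rw [hw _ hy]
      simp [τ]

/-- A map out of the target of a surjective submersion is smooth if its pullback is. -/
lemma Manifold.IsSubmersion.contMDiff_of_comp [ChartedSpace F Q] {f : M → Q}
    (hf : Manifold.IsSubmersion 𝓘(ℝ, E) 𝓘(ℝ, F) ∞ f) (hs : Function.Surjective f)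
    {F' Q' : Type*} [NormedAddCommGroup F'] [NormedSpace ℝ F'] [TopologicalSpace Q']
    [ChartedSpace F' Q'] {g : Q → Q'} (hg : ContMDiff 𝓘(ℝ, E) 𝓘(ℝ, F') ∞ (g ∘ f)) :
    ContMDiff 𝓘(ℝ, F) 𝓘(ℝ, F') ∞ g := by
  intro y
  obtain ⟨x, rfl⟩ := hs y
  obtain ⟨σ, hσ, -, hfσ⟩ := (hf.isSubmersionAt x).exists_section
  -- Near `f x`, the map `g` equals `(g ∘ f) ∘ σ`.
  refine (ContMDiffAt.comp (f x) hg.contMDiffAt hσ).congr_of_eventuallyEq ?_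
  filter_upwards [hfσ] with y hy
  simp [hy]

/-- Two submersions which differ by a homeomorphism of their targets identify the smooth
structures of the targets. -/
lemma Manifold.IsSubmersion.trans_mem_maximalAtlas [ChartedSpace F Q] {f : M → Q}
    (hf : Manifold.IsSubmersion 𝓘(ℝ, E) 𝓘(ℝ, F) ∞ f) (hs : Function.Surjective f)
    {Q' : Type*} [TopologicalSpace Q'] [ChartedSpace F Q'] (hQ' : IsManifold 𝓘(ℝ, F) ∞ Q')
    (h : Q' ≃ₜ Q) (hf' : Manifold.IsSubmersion 𝓘(ℝ, E) 𝓘(ℝ, F) ∞ (h.symm ∘ f))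
    {e : OpenPartialHomeomorph Q F} (he : e ∈ IsManifold.maximalAtlas 𝓘(ℝ, F) ∞ Q) :
    h.transOpenPartialHomeomorph e ∈ IsManifold.maximalAtlas 𝓘(ℝ, F) ∞ Q' := by
  have h1 : ContMDiff 𝓘(ℝ, F) 𝓘(ℝ, F) ∞ h.symm := hf.contMDiff_of_comp hs hf'.contMDiff
  have h2 : ContMDiff 𝓘(ℝ, F) 𝓘(ℝ, F) ∞ h := by
    refine hf'.contMDiff_of_comp (h.symm.surjective.comp hs) ?_
    have : h ∘ h.symm ∘ f = f := by ext; simp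
    rw [this]
    exact hf.contMDiff
  refine OpenPartialHomeomorph.mem_maximalAtlas_of_contMDiffOn _ ?_ ?_
  · exact (contMDiffOn_of_mem_maximalAtlas he).comp h2.contMDiffOn fun x hx => hx
  · exact h1.comp_contMDiffOn (contMDiffOn_symm_of_mem_maximalAtlas he)

/-- There is at most one smooth structure for which a given surjection is a submersion. -/
theorem maximalAtlas_subset_of_isSubmersion {f : M → Q} (hs : Function.Surjective f)
    (c c' : ChartedSpace F Q) (hQ' : @IsManifold ℝ _ F _ _ F _ 𝓘(ℝ, F) ∞ Q _ c')
    (hf : letI := c; Manifold.IsSubmersion 𝓘(ℝ, E) 𝓘(ℝ, F) ∞ f)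
    (hf' : letI := c'; Manifold.IsSubmersion 𝓘(ℝ, E) 𝓘(ℝ, F) ∞ f) :
    @IsManifold.maximalAtlas ℝ _ F _ _ F _ 𝓘(ℝ, F) ∞ Q _ c ⊆
      @IsManifold.maximalAtlas ℝ _ F _ _ F _ 𝓘(ℝ, F) ∞ Q _ c' := by
  intro e he
  -- The second space is `Q` itself with the structure `c'`, and the homeomorphism is the identity.
  have := @Manifold.IsSubmersion.trans_mem_maximalAtlas E F _ _ _ _ M Q _ _ _ c f hf hs Q _ c' hQ'
    (Homeomorph.refl Q) hf' e he
  have he' : (Homeomorph.refl Q).transOpenPartialHomeomorph e = e := by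
    ext <;> simp
  rwa [he'] at this

end SubmersionUnique

namespace SymSys

variable {n m p : ℕ}

/-! ### Freeness -/

/-- `S` carries a trajectory from `0` to the trajectory of the conjugated system with the same
input. That system is the original one, so `S` fixes every state reachable from `0`. -/
lemma IsControllable.eq_one_of_conj {A : Matrix (Fin n) (Fin n) ℝ} {B : Matrix (Fin n) (Fin m) ℝ}
    (hc : IsControllable A B) {S T : Matrix (Fin n) (Fin n) ℝ} (h : T * S = 1)
    (hA : S * A * T = A) (hB : S * B = B) : S = 1 := by
  refine Matrix.toLin'.injective (LinearMap.ext fun z => ?_)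
  obtain ⟨K, u, rfl⟩ := hc 0 z
  have := state_conj (A := A) (B := B) h 0 u K
  rw [hA, hB, Matrix.mulVec_zero] at this
  simp [← this]

/-- Infinitesimal freeness: the kernel of `X` is invariant under `A` and contains the range of `B`,
hence contains all states reachable from `0`. -/
lemma IsControllable.eq_zero_of_commute {A : Matrix (Fin n) (Fin n) ℝ}
    {B : Matrix (Fin n) (Fin m) ℝ} (hc : IsControllable A B) {X : Matrix (Fin n) (Fin n) ℝ}
    (hA : X * A = A * X) (hB : X * B = 0) : X = 0 := by
  refine Matrix.toLin'.injective (LinearMap.ext fun z => ?_)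
  obtain ⟨K, u, rfl⟩ := hc 0 z
  suffices X *ᵥ state A B 0 u K = 0 by simpa using this
  clear hc
  induction K with
  | zero => simp [state]
  | succ k ih =>
    rw [state, Matrix.mulVec_add, Matrix.mulVec_mulVec, Matrix.mulVec_mulVec, hA, hB,
      ← Matrix.mulVec_mulVec, ih, Matrix.mulVec_zero, Matrix.zero_mulVec, add_zero]

lemma stabilizer_GL_eq_bot (Θ : MinimalTriple n m p) :
    MulAction.stabilizer (GL (Fin n) ℝ)ᵐᵒᵖ Θ = ⊥ := by
  refine (Subgroup.eq_bot_iff_forall _).2 fun g hg => ?_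
  have hg' : g • Θ = Θ := hg
  have h := Θ.controllable.eq_one_of_conj (g.unop.mul_inv) (congrArg MinimalTriple.A hg')
    (congrArg MinimalTriple.B hg')
  have h1 : g.unop⁻¹ = 1 := Units.ext h
  exact MulOpposite.unop_injective (inv_eq_one.1 h1)

lemma eq_one_of_act_eq {U : O n} {Θ : N n m p} (h : act U Θ = Θ) : U = 1 := by
  have hA : (U : Matrix (Fin n) (Fin n) ℝ)ᵀ * Θ.1.A * (U : Matrix (Fin n) (Fin n) ℝ) = Θ.1.A :=
    congrArg (fun Θ : N n m p => Θ.1.A) h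
  have hB : (U : Matrix (Fin n) (Fin n) ℝ)ᵀ * Θ.1.B = Θ.1.B :=
    congrArg (fun Θ : N n m p => Θ.1.B) h
  have := Θ.2.2.1.eq_one_of_conj (O.mul_transpose U) hA hB
  exact Subtype.ext (Matrix.transpose_injective (by simpa using this))

lemma stabilizer_O_eq_bot (Θ : N n m p) : MulAction.stabilizer (O n)ᵐᵒᵖ Θ = ⊥ := by
  refine (Subgroup.eq_bot_iff_forall _).2 fun g hg => ?_
  exact MulOpposite.unop_injective (eq_one_of_act_eq (U := g.unop) hg)

/-! ### Compactness and properness -/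

/-- Entries of an orthogonal matrix have absolute value at most `1`, so `O n` is a closed subset of
a compact cube. -/
instance : CompactSpace (O n) := by
  refine isCompact_iff_compactSpace.1 (IsCompact.of_isClosed_subset
    (isCompact_univ_pi fun _ : Fin n => isCompact_univ_pi fun _ : Fin n =>
      isCompact_closedBall (0 : ℝ) 1) ?_ fun U hU i _ j _ => ?_)
  · have : (Matrix.orthogonalGroup (Fin n) ℝ : Set (Matrix (Fin n) (Fin n) ℝ)) =
        {U | U * Uᵀ = 1} := by
      ext U
      exact Matrix.mem_orthogonalGroup_iff (Fin n) ℝ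
    change IsClosed (Matrix.orthogonalGroup (Fin n) ℝ : Set (Matrix (Fin n) (Fin n) ℝ))
    rw [this]
    exact isClosed_eq (continuous_id.matrix_mul continuous_id.matrix_transpose) continuous_const
  · simpa using entry_norm_bound_of_unitary hU i j

lemma continuous_act : Continuous fun q : O n × N n m p => act q.1 q.2 := by
  have hU : Continuous fun q : O n × N n m p => (q.1 : Matrix (Fin n) (Fin n) ℝ) :=
    continuous_subtype_val.comp continuous_fst
  have hΘ : Continuous fun q : O n × N n m p => q.2.1 :=
    continuous_subtype_val.comp continuous_snd
  refine Continuous.subtype_mk ?_ _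
  refine Continuous.prodMk (Continuous.subtype_mk ?_ _) (Continuous.prodMk ?_ ?_)
  · exact (hU.matrix_transpose.matrix_mul ((SymTriple.continuous_A n m p).comp hΘ)).matrix_mul hU
  · exact hU.matrix_transpose.matrix_mul ((SymTriple.continuous_B n m p).comp hΘ)
  · exact ((SymTriple.continuous_C n m p).comp hΘ).matrix_mul hU

/-- Followed by the second projection, the action map is the projection off a compact factor, which
is proper; since `N × N` is Hausdorff, the action map is then proper too. -/
instance : ProperSMul (O n)ᵐᵒᵖ (N n m p) where
  isProperMap_smul_pair := by
    have h1 : Continuous fun q : (O n)ᵐᵒᵖ × N n m p => (q.1.unop, q.2) :=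
      (MulOpposite.continuous_unop.comp continuous_fst).prodMk continuous_snd
    have hc : Continuous fun q : (O n)ᵐᵒᵖ × N n m p => q.1 • q.2 :=
      Continuous.comp (f := fun q : (O n)ᵐᵒᵖ × N n m p => (q.1.unop, q.2)) continuous_act h1
    exact isProperMap_of_comp_of_t2 (hc.prodMk continuous_snd) continuous_snd
      (isProperMap_snd_of_compactSpace (X := (O n)ᵐᵒᵖ) (Y := N n m p))

/-- Elements of `O(n)` which move a point near `Θ₀` to a point near `Θ₀` are close to `1`. -/
lemma exists_nhds_forall_act_mem (Θ₀ : N n m p) {W : Set (O n)} (hW : W ∈ 𝓝 1) :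
    ∃ V ∈ 𝓝 Θ₀, ∀ U : O n, ∀ Θ ∈ V, act U Θ ∈ V → U ∈ W := by
  let f : (O n)ᵐᵒᵖ × N n m p → N n m p × N n m p := fun q => (q.1 • q.2, q.2)
  have hf : IsProperMap f := ProperSMul.isProperMap_smul_pair
  -- The image of the closed set `D` under the proper map is closed, and by freeness it misses `(Θ₀,
  -- Θ₀)`; some `V × V` therefore avoids it.
  let D : Set ((O n)ᵐᵒᵖ × N n m p) := {q | q.1.unop ∉ interior W}
  have hD : IsClosed D := (isOpen_interior.isClosed_compl).preimage
    (MulOpposite.continuous_unop.comp continuous_fst)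
  have hfD : (f '' D)ᶜ ∈ 𝓝 (Θ₀, Θ₀) := by
    refine (hf.isClosedMap _ hD).isOpen_compl.mem_nhds ?_
    rintro ⟨⟨g, Θ⟩, hg, hgΘ⟩
    obtain ⟨h1, rfl⟩ := Prod.mk.inj hgΘ
    refine hg ?_
    rw [eq_one_of_act_eq (U := g.unop) h1]
    exact mem_interior_iff_mem_nhds.2 hW
  rw [nhds_prod_eq] at hfD
  obtain ⟨V, hV, hVD⟩ := mem_prod_same_iff.1 hfD
  refine ⟨V, hV, fun U Θ hΘ hUΘ => ?_⟩
  by_contra hU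
  exact hVD (mk_mem_prod hUΘ hΘ) ⟨(MulOpposite.op U, Θ), fun h => hU (interior_subset h), rfl⟩

instance : FiniteDimensional ℝ (SymTriple n m p) :=
  inferInstanceAs (FiniteDimensional ℝ
    (symMatrix n × Matrix (Fin n) (Fin m) ℝ × Matrix (Fin p) (Fin n) ℝ))

instance : SecondCountableTopology (SymTriple n m p) :=
  have : ProperSpace (SymTriple n m p) := FiniteDimensional.proper_real _
  inferInstance

instance : SecondCountableTopology (NQuot n m p) :=
  ContinuousConstSMul.secondCountableTopology

instance : T2Space (NQuot n m p) :=
  t2Space_quotient_mulAction_of_properSMul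

end SymSys

namespace SymSys

variable {n m p : ℕ}

/-! ### Symmetric and skew-symmetric matrices -/

/-- The space of skew-symmetric real matrices. -/
def skewMatrix (n : ℕ) : Submodule ℝ (Matrix (Fin n) (Fin n) ℝ) where
  carrier := {X | Xᵀ = -X}
  add_mem' {X Y} hX hY := by
    rw [mem_ofPred_eq] at *
    rw [Matrix.transpose_add, hX, hY, neg_add]
  zero_mem' := by simp
  smul_mem' c X hX := by
    rw [mem_ofPred_eq] at *
    rw [Matrix.transpose_smul, hX, smul_neg]

lemma mem_skewMatrix {X : Matrix (Fin n) (Fin n) ℝ} : X ∈ skewMatrix n ↔ Xᵀ = -X := Iff.rfl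

lemma mem_symMatrix {X : Matrix (Fin n) (Fin n) ℝ} : X ∈ symMatrix n ↔ Xᵀ = X := Iff.rfl

lemma isCompl_symMatrix_skewMatrix (n : ℕ) : IsCompl (symMatrix n) (skewMatrix n) := by
  refine ⟨Submodule.disjoint_def.2 fun X h1 h2 => ?_, Submodule.codisjoint_iff_exists_add_eq.2
    fun X => ⟨(1 / 2 : ℝ) • (X + Xᵀ), (1 / 2 : ℝ) • (X - Xᵀ), ?_, ?_, ?_⟩⟩
  · rw [mem_symMatrix] at h1
    rw [mem_skewMatrix, h1] at h2
    ext i j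
    have := congrFun (congrFun h2 i) j
    simp only [Matrix.neg_apply] at this
    simpa using self_eq_neg.1 this
  · simp [mem_symMatrix, add_comm]
  · simp [mem_skewMatrix]
  · module

/-- A symmetric matrix is a function on unordered pairs of indices. -/
def symMatrixEquiv (n : ℕ) : symMatrix n ≃ₗ[ℝ] (Sym2 (Fin n) → ℝ) where
  toFun A := fun z => Sym2.lift ⟨fun i j => A.1 i j, fun i j => (A.2.apply i j).symm⟩ z
  invFun f := ⟨Matrix.of fun i j => f s(i, j), by
    ext i j
    simp [Sym2.eq_swap]⟩
  left_inv A := by ext; rfl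
  right_inv f := by
    ext z
    induction z with
    | _ i j => rfl
  map_add' A B := by
    ext z
    induction z with
    | _ i j => rfl
  map_smul' c A := by
    ext z
    induction z with
    | _ i j => rfl

lemma finrank_symMatrix (n : ℕ) : Module.finrank ℝ (symMatrix n) = (n + 1).choose 2 := by
  rw [(symMatrixEquiv n).finrank_eq, Module.finrank_fintype_fun_eq_card, Sym2.card,
    Fintype.card_fin]

lemma finrank_skewMatrix (n : ℕ) : Module.finrank ℝ (skewMatrix n) = n.choose 2 := by
  have h := Submodule.finrank_add_eq_of_isCompl (isCompl_symMatrix_skewMatrix n)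
  rw [finrank_symMatrix, Module.finrank_matrix, Fintype.card_fin, Module.finrank_self,
    Nat.choose_succ_succ' n 1, Nat.choose_one_right] at h
  have h2 : n * n = n + 2 * n.choose 2 := by
    rw [Nat.choose_two_right, Nat.mul_div_cancel' (Nat.even_mul_pred_self n).two_dvd]
    cases n with
    | zero => rfl
    | succ k => simp; ring
  simp only [Nat.reduceAdd] at h
  omega

/-- Since `(n + 1).choose 2 = n + n.choose 2`, the dimension of `O(n)` splits off and leaves that of
the quotient. -/
lemma finrank_symTriple (n m p : ℕ) :
    Module.finrank ℝ (SymTriple n m p) = n * (m + p + 1) + n.choose 2 := by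
  change Module.finrank ℝ
    (symMatrix n × Matrix (Fin n) (Fin m) ℝ × Matrix (Fin p) (Fin n) ℝ) = _
  rw [Module.finrank_prod, Module.finrank_prod, finrank_symMatrix, Module.finrank_matrix,
    Module.finrank_matrix, Module.finrank_self, Nat.choose_succ_succ' n 1, Nat.choose_one_right]
  simp only [Fintype.card_fin]
  ring

/-! ### The Cayley transform -/

/-- The Cayley transform `(1 + X) (1 - X)⁻¹`. -/
noncomputable def cayley (X : Matrix (Fin n) (Fin n) ℝ) : Matrix (Fin n) (Fin n) ℝ :=
  -- Here `1 + X` has been written as `2 - (1 - X)`, so that `X` enters only through the inverse.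
  (2 : ℝ) • (1 - X)⁻¹ - 1

/-- If `X v = v` with `X` skew-symmetric, then `v ⬝ᵥ v = v ⬝ᵥ X *ᵥ v = 0`. -/
lemma isUnit_one_sub_of_mem_skewMatrix {X : Matrix (Fin n) (Fin n) ℝ} (hX : X ∈ skewMatrix n) :
    IsUnit (1 - X).det := by
  rw [isUnit_iff_ne_zero]
  intro h
  obtain ⟨v, hv, hv'⟩ := Matrix.exists_mulVec_eq_zero_iff.mpr h
  have h1 : v = X *ᵥ v := by
    rwa [Matrix.sub_mulVec, Matrix.one_mulVec, sub_eq_zero] at hv'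
  have h2 : v ⬝ᵥ X *ᵥ v = - (v ⬝ᵥ X *ᵥ v) := by
    conv_lhs => rw [Matrix.dotProduct_mulVec, ← Matrix.mulVec_transpose, mem_skewMatrix.1 hX,
      Matrix.neg_mulVec, neg_dotProduct, dotProduct_comm]
  rw [self_eq_neg, ← h1] at h2
  exact hv (dotProduct_self_eq_zero.1 h2)

lemma cayley_mem_orthogonalGroup {X : Matrix (Fin n) (Fin n) ℝ} (hX : X ∈ skewMatrix n) :
    cayley X ∈ Matrix.orthogonalGroup (Fin n) ℝ := by
  rw [Matrix.mem_orthogonalGroup_iff' (Fin n) ℝ]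
  have h1 := isUnit_one_sub_of_mem_skewMatrix hX
  have h2 := isUnit_one_sub_of_mem_skewMatrix (neg_mem hX)
  rw [sub_neg_eq_add] at h2
  have h3 : (cayley X)ᵀ = (2 : ℝ) • (1 + X)⁻¹ - 1 := by
    simp [cayley, Matrix.transpose_nonsing_inv, mem_skewMatrix.1 hX]
  -- Resolvent identity, from `(1 + X) + (1 - X) = 2`.
  have e3 : (2 : ℝ) • ((1 + X)⁻¹ * (1 - X)⁻¹) = (1 - X)⁻¹ + (1 + X)⁻¹ := by
    calc (2 : ℝ) • ((1 + X)⁻¹ * (1 - X)⁻¹)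
        = (1 + X)⁻¹ * ((1 + X) + (1 - X)) * (1 - X)⁻¹ := by
          rw [show (1 + X) + (1 - X) = (2 : ℝ) • (1 : Matrix (Fin n) (Fin n) ℝ) by module,
            Matrix.mul_smul, Matrix.mul_one, Matrix.smul_mul]
      _ = _ := by
          rw [Matrix.mul_add, Matrix.add_mul, Matrix.nonsing_inv_mul _ h2, Matrix.one_mul,
            Matrix.mul_assoc, Matrix.mul_nonsing_inv _ h1, Matrix.mul_one]
  rw [h3, cayley]
  simp only [sub_mul, mul_sub, mul_one, one_mul, smul_mul_assoc, mul_smul_comm]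
  rw [e3]
  module

/-- The argument is the solution `X` of `2 (1 - X)⁻¹ - 1 = V`. -/
lemma cayley_inverse {V : Matrix (Fin n) (Fin n) ℝ} (hV : IsUnit (1 + V).det) :
    cayley (1 - (2 : ℝ) • (1 + V)⁻¹) = V := by
  have : ((2 : ℝ) • (1 + V)⁻¹)⁻¹ = (1 / 2 : ℝ) • (1 + V) := by
    refine Matrix.inv_eq_right_inv ?_
    rw [smul_mul_smul_comm, Matrix.nonsing_inv_mul _ hV]
    norm_num
  rw [cayley, sub_sub_cancel, this]
  module

/-- Orthogonality gives `(1 + Vᵀ) V = 1 + V`, so `(1 + Vᵀ)⁻¹ = V (1 + V)⁻¹ = 1 - (1 + V)⁻¹`. -/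
lemma one_sub_inv_mem_skewMatrix {V : Matrix (Fin n) (Fin n) ℝ}
    (hV : V ∈ Matrix.orthogonalGroup (Fin n) ℝ) (h : IsUnit (1 + V).det) :
    1 - (2 : ℝ) • (1 + V)⁻¹ ∈ skewMatrix n := by
  have h1 : V * Vᵀ = 1 := (Matrix.mem_orthogonalGroup_iff (Fin n) ℝ).1 hV
  have h2 : (1 + Vᵀ)⁻¹ = V * (1 + V)⁻¹ := by
    refine Matrix.inv_eq_right_inv ?_
    have : (1 + Vᵀ) * V = 1 + V := by
      rw [Matrix.add_mul, mul_eq_one_comm.1 h1, Matrix.one_mul, add_comm]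
    rw [← Matrix.mul_assoc, this, Matrix.mul_nonsing_inv _ h]
  have h3 : (1 + V)⁻¹ + V * (1 + V)⁻¹ = 1 := by
    conv_lhs => rw [← Matrix.one_mul (1 + V)⁻¹, ← Matrix.mul_assoc, Matrix.mul_one,
      ← Matrix.add_mul, Matrix.mul_nonsing_inv _ h]
  rw [mem_skewMatrix, Matrix.transpose_sub, Matrix.transpose_smul, Matrix.transpose_nonsing_inv,
    Matrix.transpose_one, Matrix.transpose_add, Matrix.transpose_one, h2, ← sub_eq_zero]
  have : V * (1 + V)⁻¹ = 1 - (1 + V)⁻¹ := eq_sub_of_add_eq' h3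
  rw [this]
  module

end SymSys

namespace SymSys

variable {n m p : ℕ}

/-! ### The action of arbitrary matrices by congruence -/

/-- The triple with the symmetric part of `A`. -/
noncomputable def ofMatrices (n m p : ℕ) : (Matrix (Fin n) (Fin n) ℝ × Matrix (Fin n) (Fin m) ℝ ×
    Matrix (Fin p) (Fin n) ℝ) →ₗ[ℝ] SymTriple n m p where
  toFun q := (⟨(1 / 2 : ℝ) • (q.1 + q.1ᵀ), by simp [mem_symMatrix, add_comm]⟩, q.2.1, q.2.2)
  map_add' q r := by
    refine Prod.ext (Subtype.ext ?_) rfl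
    change (1 / 2 : ℝ) • (q.1 + r.1 + (q.1 + r.1)ᵀ) =
      (1 / 2 : ℝ) • (q.1 + q.1ᵀ) + (1 / 2 : ℝ) • (r.1 + r.1ᵀ)
    rw [Matrix.transpose_add]
    module
  map_smul' c q := by
    refine Prod.ext (Subtype.ext ?_) rfl
    change (1 / 2 : ℝ) • (c • q.1 + (c • q.1)ᵀ) = c • (1 / 2 : ℝ) • (q.1 + q.1ᵀ)
    rw [Matrix.transpose_smul]
    module

/-- Symmetrization is the identity on symmetric matrices. It extends the formulas linearly to all
matrices, so that derivatives can be taken in an unconstrained `U`. -/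
lemma ofMatrices_injOn {X X' : Matrix (Fin n) (Fin n) ℝ} {Y Y' : Matrix (Fin n) (Fin m) ℝ}
    {Z Z' : Matrix (Fin p) (Fin n) ℝ} (hX : Xᵀ = X) (hX' : X'ᵀ = X')
    (h : ofMatrices n m p (X, Y, Z) = ofMatrices n m p (X', Y', Z')) :
    X = X' ∧ Y = Y' ∧ Z = Z' := by
  refine ⟨?_, congrArg SymTriple.B h, congrArg SymTriple.C h⟩
  have h1 : (1 / 2 : ℝ) • (X + Xᵀ) = (1 / 2 : ℝ) • (X' + X'ᵀ) := congrArg SymTriple.A h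
  rw [hX, hX', ← two_smul ℝ X, ← two_smul ℝ X', smul_smul, smul_smul] at h1
  simpa using h1

/-- The linear map `Θ ↦ (Uᵀ A U, Uᵀ B, C U)`, for an arbitrary matrix `U`. -/
noncomputable def congrAct (m p : ℕ) (U : Matrix (Fin n) (Fin n) ℝ) :
    SymTriple n m p →ₗ[ℝ] SymTriple n m p where
  toFun Θ := ofMatrices n m p (Uᵀ * Θ.A * U, Uᵀ * Θ.B, Θ.C * U)
  map_add' Θ Θ' := by
    rw [← map_add]
    congr 1
    refine Prod.ext ?_ (Prod.ext ?_ ?_)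
    · change Uᵀ * (Θ.A + Θ'.A) * U = _
      simp [Matrix.mul_add, Matrix.add_mul]
    · exact Matrix.mul_add _ _ _
    · exact Matrix.add_mul _ _ _
  map_smul' c Θ := by
    rw [RingHom.id_apply, ← map_smul]
    congr 1
    refine Prod.ext ?_ (Prod.ext ?_ ?_)
    · change Uᵀ * (c • Θ.A) * U = _
      simp
    · exact Matrix.mul_smul _ _ _
    · exact Matrix.smul_mul _ _ _

lemma SymTriple.transpose_A (Θ : SymTriple n m p) : Θ.Aᵀ = Θ.A := Θ.1.2

lemma coe_act (U : O n) (Θ : N n m p) : (act U Θ : SymTriple n m p) = congrAct m p U Θ := by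
  refine Prod.ext (Subtype.ext ?_) rfl
  change (U : Matrix (Fin n) (Fin n) ℝ)ᵀ * Θ.1.A * (U : Matrix (Fin n) (Fin n) ℝ) =
    (1 / 2 : ℝ) • ((U : Matrix (Fin n) (Fin n) ℝ)ᵀ * Θ.1.A * (U : Matrix (Fin n) (Fin n) ℝ) +
      ((U : Matrix (Fin n) (Fin n) ℝ)ᵀ * Θ.1.A * (U : Matrix (Fin n) (Fin n) ℝ))ᵀ)
  rw [Matrix.transpose_mul, Matrix.transpose_mul, Matrix.transpose_transpose,
    Θ.1.transpose_A, Matrix.mul_assoc]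
  module

lemma congrAct_one (Θ : SymTriple n m p) : congrAct m p 1 Θ = Θ := by
  refine Prod.ext (Subtype.ext ?_) (Prod.ext ?_ ?_)
  · change (1 / 2 : ℝ) • ((1 : Matrix (Fin n) (Fin n) ℝ)ᵀ * Θ.A * 1 +
      ((1 : Matrix (Fin n) (Fin n) ℝ)ᵀ * Θ.A * 1)ᵀ) = Θ.A
    simp only [Matrix.transpose_one, Matrix.one_mul, Matrix.mul_one, Θ.transpose_A]
    module
  · change (1 : Matrix (Fin n) (Fin n) ℝ)ᵀ * Θ.B = Θ.B
    simp
  · change Θ.C * (1 : Matrix (Fin n) (Fin n) ℝ) = Θ.C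
    simp

/-- The action of every element of `O(n)` is smooth. -/
lemma contMDiff_act (U : O n) : ContMDiff 𝓘(ℝ, SymTriple n m p) 𝓘(ℝ, SymTriple n m p) ∞
    (act U : N n m p → N n m p) := by
  -- Since `N` is open, its inclusion is an immersion with trivial complement `PUnit`; smoothness is
  -- thus tested in the vector space, where the action is linear.
  refine (ContMDiff.iff_comp_isImmersionOfComplement
    (F := PUnit.{1}) (Manifold.IsImmersionOfComplement.of_opens (N n m p))).2 ⟨?_, ?_⟩
  · exact Continuous.comp (f := fun Θ : N n m p => (U, Θ)) continuous_act (by fun_prop)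
  · have h : (Subtype.val ∘ act U : N n m p → SymTriple n m p) =
        LinearMap.toContinuousLinearMap (congrAct m p (U : Matrix (Fin n) (Fin n) ℝ)) ∘
          Subtype.val := funext fun Θ => coe_act U Θ
    rw [h]
    exact (ContinuousLinearMap.contDiff _).contMDiff.comp contMDiff_subtype_val

/-! ### Derivatives of the action and of the Cayley transform -/

section Smooth

-- A submultiplicative norm makes matrices a normed algebra, in which multiplication and inversion
-- are smooth.
attribute [local instance] Matrix.linftyOpNormedAddCommGroup Matrix.linftyOpNormedSpace
  Matrix.linftyOpNormedRing Matrix.linftyOpNormedAlgebra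

lemma contDiff_of_linearMap {X Y : Type*} [NormedAddCommGroup X] [NormedSpace ℝ X]
    [FiniteDimensional ℝ X] [NormedAddCommGroup Y] [NormedSpace ℝ Y] (f : X →ₗ[ℝ] Y)
    {k : WithTop ℕ∞} : ContDiff ℝ k f :=
  (LinearMap.toContinuousLinearMap f).contDiff

lemma hasDerivAt_of_linearMap {X Y : Type*} [NormedAddCommGroup X] [NormedSpace ℝ X]
    [FiniteDimensional ℝ X] [NormedAddCommGroup Y] [NormedSpace ℝ Y] (f : X →ₗ[ℝ] Y)
    {c : ℝ → X} {c' : X} {t : ℝ} (hc : HasDerivAt c c' t) :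
    HasDerivAt (fun t => f (c t)) (f c') t :=
  (LinearMap.toContinuousLinearMap f).hasFDerivAt.comp_hasDerivAt t hc

/-- Left multiplication as a linear map in the transpose of the left factor. -/
def transposeMul {k l : ℕ} (B : Matrix (Fin k) (Fin l) ℝ) :
    Matrix (Fin k) (Fin k) ℝ →ₗ[ℝ] Matrix (Fin k) (Fin l) ℝ where
  toFun U := Uᵀ * B
  map_add' := by simp [Matrix.add_mul]
  map_smul' := by simp

/-- Left multiplication as a linear map. -/
def leftMul {k l : ℕ} (C : Matrix (Fin l) (Fin k) ℝ) :
    Matrix (Fin k) (Fin k) ℝ →ₗ[ℝ] Matrix (Fin l) (Fin k) ℝ where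
  toFun U := C * U
  map_add' := by simp [Matrix.mul_add]
  map_smul' := by simp

lemma contDiff_congrAct (Θ : SymTriple n m p) {k : WithTop ℕ∞} :
    ContDiff ℝ k fun U : Matrix (Fin n) (Fin n) ℝ => congrAct m p U Θ := by
  refine (contDiff_of_linearMap (ofMatrices n m p)).comp
    (ContDiff.prodMk ?_ (ContDiff.prodMk ?_ ?_))
  · exact (contDiff_of_linearMap (transposeMul Θ.A)).mul contDiff_id
  · exact contDiff_of_linearMap (transposeMul Θ.B)
  · exact contDiff_of_linearMap (leftMul Θ.C)

lemma hasDerivAt_congrAct (Θ : SymTriple n m p) {c : ℝ → Matrix (Fin n) (Fin n) ℝ}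
    {Z : Matrix (Fin n) (Fin n) ℝ} {t : ℝ} (hc : HasDerivAt c Z t) (h1 : c t = 1) :
    HasDerivAt (fun t => congrAct m p (c t) Θ)
      (ofMatrices n m p (Zᵀ * Θ.A + Θ.A * Z, Zᵀ * Θ.B, Θ.C * Z)) t := by
  refine hasDerivAt_of_linearMap (ofMatrices n m p)
    (HasDerivAt.prodMk ?_ (HasDerivAt.prodMk ?_ ?_))
  · have := (hasDerivAt_of_linearMap (transposeMul Θ.A) hc).mul hc
    exact this.congr_deriv (by simp [transposeMul, h1])
  · exact hasDerivAt_of_linearMap (transposeMul Θ.B) hc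
  · exact hasDerivAt_of_linearMap (leftMul Θ.C) hc

lemma contDiffAt_cayley {X : Matrix (Fin n) (Fin n) ℝ} (hX : IsUnit (1 - X).det)
    {k : WithTop ℕ∞} : ContDiffAt ℝ k cayley X := by
  have h : (cayley : Matrix (Fin n) (Fin n) ℝ → _) =
      fun X => (2 : ℝ) • Ring.inverse (1 - X) - 1 := by
    ext1 X
    rw [cayley, Matrix.nonsing_inv_eq_ringInverse]
  rw [h]
  obtain ⟨u, hu⟩ := (Matrix.isUnit_iff_isUnit_det _).2 hX
  have h1 : ContDiffAt ℝ k Ring.inverse (1 - X) := by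
    rw [← hu]
    exact contDiffAt_ringInverse ℝ u
  exact ((h1.comp X (contDiffAt_const.sub contDiffAt_id)).const_smul (2 : ℝ)).sub contDiffAt_const

/-- Inversion has derivative `Y ↦ -Y` at `1`, so `(1 - t X)⁻¹` has derivative `X`. This is the
source of the factor `2` in front of `orbitTangent`. -/
lemma hasDerivAt_cayley (X : Matrix (Fin n) (Fin n) ℝ) :
    HasDerivAt (fun t : ℝ => cayley (t • X)) ((2 : ℝ) • X) 0 := by
  have h : (fun t : ℝ => cayley (t • X)) =
      fun t => (2 : ℝ) • Ring.inverse (1 - t • X) - 1 := by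
    ext1 t
    rw [cayley, Matrix.nonsing_inv_eq_ringInverse]
  rw [h]
  have h1 := ((hasDerivAt_id (0 : ℝ)).smul_const X).const_sub 1
  have h2 := hasFDerivAt_ringInverse (𝕜 := ℝ) (1 : (Matrix (Fin n) (Fin n) ℝ)ˣ)
  have h0 : ((1 : (Matrix (Fin n) (Fin n) ℝ)ˣ) : Matrix (Fin n) (Fin n) ℝ) =
      1 - id (0 : ℝ) • X := by simp
  rw [h0] at h2
  have h3 := ((h2.comp_hasDerivAt 0 h1).const_smul (2 : ℝ)).sub_const 1
  exact h3.congr_deriv (by simp)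

end Smooth

lemma cayley_zero : cayley (0 : Matrix (Fin n) (Fin n) ℝ) = 1 := by
  simp [cayley]
  module

end SymSys

namespace SymSys

variable {n m p : ℕ}

/-! ### Slices -/

/-- The differential at `1` of the orbit map of `Θ`. -/
noncomputable def orbitTangent (Θ : SymTriple n m p) :
    Matrix (Fin n) (Fin n) ℝ →ₗ[ℝ] SymTriple n m p :=
  ofMatrices n m p ∘ₗ
    ((transposeMul Θ.A + leftMul Θ.A).prod ((transposeMul Θ.B).prod (leftMul Θ.C)))

lemma orbitTangent_apply (Θ : SymTriple n m p) (X : Matrix (Fin n) (Fin n) ℝ) :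
    orbitTangent Θ X = ofMatrices n m p (Xᵀ * Θ.A + Θ.A * X, Xᵀ * Θ.B, Θ.C * X) := rfl

/-- For skew-symmetric `X` the first two components are `A X - X A` and `-X B`. -/
lemma eq_zero_of_orbitTangent_eq_zero {Θ : SymTriple n m p} (hc : IsControllable Θ.A Θ.B)
    {X : Matrix (Fin n) (Fin n) ℝ} (hX : X ∈ skewMatrix n) (h : orbitTangent Θ X = 0) :
    X = 0 := by
  rw [orbitTangent_apply, ← map_zero (ofMatrices n m p)] at h
  obtain ⟨hA, hB, -⟩ := ofMatrices_injOn (X' := 0) (Y' := 0) (Z' := 0)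
    (by simp [Θ.transpose_A, add_comm]) (by simp) h
  rw [mem_skewMatrix.1 hX] at hA hB
  refine hc.eq_zero_of_commute ?_ ?_
  · rw [Matrix.neg_mul, neg_add_eq_zero] at hA
    exact hA
  · simpa using hB

/-- The model space of the orbit space. -/
abbrev SliceModel (n m p : ℕ) : Type := EuclideanSpace ℝ (Fin (n * (m + p + 1)))

/-- The model space of the orbits. -/
abbrev OrbitModel (n : ℕ) : Type := EuclideanSpace ℝ (Fin (n.choose 2))

/-- Coordinates on the Lie algebra of `O(n)`. -/
noncomputable def skewCoord (n : ℕ) : OrbitModel n ≃ₗ[ℝ] skewMatrix n :=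
  LinearEquiv.ofFinrankEq _ _ (by rw [finrank_euclideanSpace_fin, finrank_skewMatrix])

/-- `σ` parametrizes a complement of the tangent space of the orbit, whose dimension is known
because the orbit map is immersive. The coproduct is the differential of `sliceMap` at `0`. -/
lemma exists_complement_orbitTangent {Θ : SymTriple n m p} (hc : IsControllable Θ.A Θ.B) :
    ∃ σ : SliceModel n m p →ₗ[ℝ] SymTriple n m p, Function.Injective
      (σ.coprod ((2 : ℝ) • orbitTangent Θ ∘ₗ (skewMatrix n).subtype ∘ₗ
        (skewCoord n).toLinearMap)) := by
  set τ := (2 : ℝ) • orbitTangent Θ ∘ₗ (skewMatrix n).subtype ∘ₗ (skewCoord n).toLinearMap with hτ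
  have hτi : Function.Injective τ := by
    refine (injective_iff_map_eq_zero _).2 fun v hv => ?_
    have h1 : orbitTangent Θ (skewCoord n v) = 0 := by
      have : (2 : ℝ) • orbitTangent Θ (skewCoord n v) = 0 := hv
      simpa using this
    have h2 := eq_zero_of_orbitTangent_eq_zero hc (skewCoord n v).2 h1
    simpa using h2
  obtain ⟨S, hS⟩ := τ.range.exists_isCompl
  have hd := Submodule.finrank_add_eq_of_isCompl hS
  rw [LinearMap.finrank_range_of_inj hτi, finrank_symTriple, finrank_euclideanSpace_fin] at hd
  let σ : SliceModel n m p ≃ₗ[ℝ] S := LinearEquiv.ofFinrankEq _ _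
    (by rw [finrank_euclideanSpace_fin]; omega)
  refine ⟨S.subtype ∘ₗ σ.toLinearMap, (injective_iff_map_eq_zero _).2 ?_⟩
  rintro ⟨s, v⟩ h
  have h1 : (σ s : SymTriple n m p) + τ v = 0 := h
  have h2 : τ v = 0 := by
    refine Submodule.disjoint_def.1 hS.disjoint _ ⟨v, rfl⟩ ?_
    rw [← neg_eq_of_add_eq_zero_right h1]
    exact neg_mem (σ s).2
  have h3 : σ s = 0 := by
    rw [h2, add_zero] at h1
    exact Subtype.ext h1
  exact Prod.ext (by simpa using h3) (hτi (by rw [h2, Prod.snd_zero, map_zero]))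

/-- The map `(s, X) ↦ U ∘ (Θ₀ + s)`, with `U ∈ O(n)` the Cayley transform of `X`. -/
noncomputable def sliceMap (Θ₀ : SymTriple n m p) (σ : SliceModel n m p →ₗ[ℝ] SymTriple n m p)
    (q : SliceModel n m p × OrbitModel n) : SymTriple n m p :=
  congrAct m p (cayley (skewCoord n q.2 : Matrix (Fin n) (Fin n) ℝ)) (Θ₀ + σ q.1)

lemma sliceMap_zero_right (Θ₀ : SymTriple n m p)
    (σ : SliceModel n m p →ₗ[ℝ] SymTriple n m p) (s : SliceModel n m p) :
    sliceMap Θ₀ σ (s, 0) = Θ₀ + σ s := by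
  simp [sliceMap, cayley_zero, congrAct_one]

section Smooth

attribute [local instance] Matrix.linftyOpNormedAddCommGroup Matrix.linftyOpNormedSpace
  Matrix.linftyOpNormedRing Matrix.linftyOpNormedAlgebra

/-- Smoothness is global because `1 - X` is invertible for every skew-symmetric `X`. -/
lemma contDiff_sliceMap (Θ₀ : SymTriple n m p) (σ : SliceModel n m p →ₗ[ℝ] SymTriple n m p)
    {k : WithTop ℕ∞} : ContDiff ℝ k (sliceMap Θ₀ σ) := by
  have h1 : ContDiff ℝ k fun U : Matrix (Fin n) (Fin n) ℝ =>
      LinearMap.toContinuousLinearMap (congrAct m p U) :=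
    contDiff_clm_apply_iff.2 fun Θ => contDiff_congrAct Θ
  have h2 : ContDiff ℝ k fun v : OrbitModel n =>
      cayley (skewCoord n v : Matrix (Fin n) (Fin n) ℝ) := by
    refine contDiff_iff_contDiffAt.2 fun v => ?_
    exact (contDiffAt_cayley (isUnit_one_sub_of_mem_skewMatrix (skewCoord n v).2)).comp v
      (contDiff_of_linearMap ((skewMatrix n).subtype ∘ₗ (skewCoord n).toLinearMap)).contDiffAt
  exact (h1.comp (h2.comp contDiff_snd)).clm_apply
    (contDiff_const.add ((contDiff_of_linearMap σ).comp contDiff_fst))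

lemma hasFDerivAt_sliceMap (Θ₀ : SymTriple n m p)
    (σ : SliceModel n m p →ₗ[ℝ] SymTriple n m p) :
    HasFDerivAt (sliceMap Θ₀ σ) (LinearMap.toContinuousLinearMap
      (σ.coprod ((2 : ℝ) • orbitTangent Θ₀ ∘ₗ (skewMatrix n).subtype ∘ₗ
        (skewCoord n).toLinearMap))) 0 := by
  have h := ((contDiff_sliceMap Θ₀ σ (k := 1)).differentiable one_ne_zero 0).hasFDerivAt
  -- The differential is known to exist, so derivatives along lines in the two factors determine it.
  have hline : ∀ w : SliceModel n m p × OrbitModel n,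
      HasDerivAt (fun t : ℝ => sliceMap Θ₀ σ (t • w)) (fderiv ℝ (sliceMap Θ₀ σ) 0 w) 0 := by
    intro w
    have hw : HasDerivAt (fun t : ℝ => t • w) w 0 := by
      simpa using (hasDerivAt_id (0 : ℝ)).smul_const w
    have h' : HasFDerivAt (sliceMap Θ₀ σ) (fderiv ℝ (sliceMap Θ₀ σ) 0) ((0 : ℝ) • w) := by
      rwa [zero_smul]
    exact h'.comp_hasDerivAt 0 hw
  refine h.congr_fderiv (ContinuousLinearMap.coe_injective (LinearMap.prod_ext ?_ ?_))
  · refine LinearMap.ext fun s => ?_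
    have h1 := hline (s, 0)
    have h2 : HasDerivAt (fun t : ℝ => Θ₀ + t • σ s) (σ s) 0 := by
      simpa using ((hasDerivAt_id (0 : ℝ)).smul_const (σ s)).const_add Θ₀
    have h3 : (fun t : ℝ => sliceMap Θ₀ σ (t • (s, 0))) = fun t => Θ₀ + t • σ s := by
      ext1 t
      rw [Prod.smul_mk, smul_zero, sliceMap_zero_right, map_smul]
    rw [h3] at h1
    simpa using h1.unique h2
  · refine LinearMap.ext fun v => ?_
    have h1 := hline (0, v)
    have h2 := hasDerivAt_congrAct Θ₀
      (hasDerivAt_cayley (skewCoord n v : Matrix (Fin n) (Fin n) ℝ)) (by simp [cayley_zero])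
    have h3 : (fun t : ℝ => sliceMap Θ₀ σ (t • (0, v))) = fun t : ℝ =>
        congrAct m p (cayley (t • (skewCoord n v : Matrix (Fin n) (Fin n) ℝ))) Θ₀ := by
      ext1 t
      simp [sliceMap]
    rw [h3] at h1
    have h4 := h1.unique h2
    rw [← orbitTangent_apply, map_smul] at h4
    simpa using h4

end Smooth

/-- Near `Θ₀`, the map `sliceMap Θ₀ σ` is a diffeomorphism. -/
lemma exists_openPartialHomeomorph_sliceMap {Θ₀ : SymTriple n m p}
    (hc : IsControllable Θ₀.A Θ₀.B) :
    ∃ (σ : SliceModel n m p →ₗ[ℝ] SymTriple n m p)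
      (Φ : OpenPartialHomeomorph (SliceModel n m p × OrbitModel n) (SymTriple n m p)),
      (Φ : SliceModel n m p × OrbitModel n → SymTriple n m p) = sliceMap Θ₀ σ ∧
      (0 : SliceModel n m p × OrbitModel n) ∈ Φ.source ∧ ContDiffOn ℝ ∞ Φ.symm Φ.target := by
  obtain ⟨σ, hσ⟩ := exists_complement_orbitTangent hc
  let D := LinearMap.linearEquivOfInjective _ hσ (by
    rw [Module.finrank_prod, finrank_euclideanSpace_fin, finrank_euclideanSpace_fin,
      finrank_symTriple])
  have hD : HasFDerivAt (sliceMap Θ₀ σ)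
      (D.toContinuousLinearEquiv : SliceModel n m p × OrbitModel n →L[ℝ] SymTriple n m p) 0 :=
    hasFDerivAt_sliceMap Θ₀ σ
  -- Regularity `ω` at a point persists on a neighborhood, whereas for `∞` the neighborhood may
  -- shrink with the order.
  have hs : ContDiffAt ℝ ω (sliceMap Θ₀ σ) 0 := (contDiff_sliceMap Θ₀ σ).contDiffAt
  let Φ := hs.toOpenPartialHomeomorph _ hD (by simp)
  have h0 : (0 : SliceModel n m p × OrbitModel n) ∈ Φ.source :=
    hs.mem_toOpenPartialHomeomorph_source hD _
  refine ⟨σ, Φ.restrContDiff ℝ ω (by simp), rfl, ⟨h0, hs, ?_⟩, ?_⟩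
  · exact hs.to_localInverse hD (by simp)
  · exact (Φ.contDiffOn_restrContDiff_target (𝕜 := ℝ) _).of_le le_top

end SymSys

/-! ### Charts of `N` adapted to the orbits -/

namespace SymSys

variable {n m p : ℕ}

/-- A linear splitting of the space of triples according to slices and orbits. -/
noncomputable def splitting (n m p : ℕ) :
    SymTriple n m p ≃L[ℝ] SliceModel n m p × OrbitModel n :=
  -- Any isomorphism serves: it only moves product coordinates into the space where charts of `N`
  -- take their values.
  ContinuousLinearEquiv.ofFinrankEq (by
    rw [Module.finrank_prod, finrank_euclideanSpace_fin, finrank_euclideanSpace_fin,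
      finrank_symTriple])

/-- Orthogonal matrices close to `1` are Cayley transforms of small skew-symmetric matrices. -/
lemma eventually_eq_cayley {B : Set (OrbitModel n)} (hB : B ∈ 𝓝 0) :
    ∀ᶠ V : O n in 𝓝 1, ∃ v ∈ B,
      cayley (skewCoord n v : Matrix (Fin n) (Fin n) ℝ) = (V : Matrix (Fin n) (Fin n) ℝ) := by
  -- `g` extends the coordinates of skew-symmetric matrices to all matrices, so the inverse Cayley
  -- transform can be followed by it even where `1 + V` is singular.
  obtain ⟨g, hg⟩ := LinearMap.exists_leftInverse_of_injective
    ((skewMatrix n).subtype ∘ₗ (skewCoord n).toLinearMap)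
    (LinearMap.ker_eq_bot.2 ((skewMatrix n).subtype_injective.comp (skewCoord n).injective))
  have hd1 : ((1 : Matrix (Fin n) (Fin n) ℝ) + ((1 : O n) : Matrix (Fin n) (Fin n) ℝ)).det ≠ 0 := by
    rw [OneMemClass.coe_one, ← two_smul ℝ (1 : Matrix (Fin n) (Fin n) ℝ), Matrix.det_smul]
    simp
  have hc : Continuous fun V : O n =>
      (1 : Matrix (Fin n) (Fin n) ℝ) + (V : Matrix (Fin n) (Fin n) ℝ) :=
    continuous_const.add continuous_subtype_val
  have hinv : ContinuousAt (fun V : O n =>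
      ((1 : Matrix (Fin n) (Fin n) ℝ) + (V : Matrix (Fin n) (Fin n) ℝ))⁻¹) 1 := by
    simp only [Matrix.inv_def, Ring.inverse_eq_inv']
    exact (hc.matrix_det.continuousAt.inv₀ hd1).smul hc.matrix_adjugate.continuousAt
  have hgc : Continuous g := g.continuous_of_finiteDimensional
  have hy : ContinuousAt (fun V : O n => g (1 - (2 : ℝ) •
      ((1 : Matrix (Fin n) (Fin n) ℝ) + (V : Matrix (Fin n) (Fin n) ℝ))⁻¹)) 1 :=
    hgc.continuousAt.comp (continuousAt_const.sub (hinv.const_smul (2 : ℝ)))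
  have hy1 : g (1 - (2 : ℝ) •
      ((1 : Matrix (Fin n) (Fin n) ℝ) + ((1 : O n) : Matrix (Fin n) (Fin n) ℝ))⁻¹) = 0 := by
    have : ((1 : Matrix (Fin n) (Fin n) ℝ) + ((1 : O n) : Matrix (Fin n) (Fin n) ℝ))⁻¹ =
        (1 / 2 : ℝ) • 1 := by
      refine Matrix.inv_eq_right_inv ?_
      rw [OneMemClass.coe_one, ← two_smul ℝ (1 : Matrix (Fin n) (Fin n) ℝ), smul_mul_smul_comm]
      norm_num
    rw [this]
    simp
  rw [ContinuousAt, hy1] at hy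
  filter_upwards [hy.eventually hB, hc.matrix_det.continuousAt.eventually_ne hd1] with V hV hd
  have hu := isUnit_iff_ne_zero.2 hd
  refine ⟨_, hV, ?_⟩
  have h1 := one_sub_inv_mem_skewMatrix V.2 hu
  have h2 : skewCoord n (g (1 - (2 : ℝ) •
      ((1 : Matrix (Fin n) (Fin n) ℝ) + (V : Matrix (Fin n) (Fin n) ℝ))⁻¹)) = ⟨_, h1⟩ := by
    have := LinearMap.congr_fun hg ((skewCoord n).symm ⟨_, h1⟩)
    simp only [LinearMap.comp_apply, LinearEquiv.coe_coe, LinearEquiv.apply_symm_apply,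
      Submodule.subtype_apply, LinearMap.id_apply] at this
    rw [this, LinearEquiv.apply_symm_apply]
  rw [h2, cayley_inverse hu]

/-- A local diffeomorphism of the ambient vector space restricts to a chart of `N`. -/
lemma mem_maximalAtlas_N (Θ₀ : N n m p)
    {Φ : OpenPartialHomeomorph (SliceModel n m p × OrbitModel n) (SymTriple n m p)}
    (h1 : ContDiff ℝ ∞ Φ) (h2 : ContDiffOn ℝ ∞ Φ.symm Φ.target) :
    (((N n m p).openPartialHomeomorphSubtypeCoe ⟨Θ₀⟩).trans Φ.symm).transHomeomorph
        (splitting n m p).symm.toHomeomorph ∈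
      IsManifold.maximalAtlas 𝓘(ℝ, SymTriple n m p) ∞ (N n m p) := by
  set φ := (((N n m p).openPartialHomeomorphSubtypeCoe ⟨Θ₀⟩).trans Φ.symm).transHomeomorph
        (splitting n m p).symm.toHomeomorph with hφ
  have hsource : ∀ x, x ∈ φ.source ↔ (x : SymTriple n m p) ∈ Φ.target := fun x => by simp [hφ]
  have hφx : ∀ x, φ x = (splitting n m p).symm (Φ.symm x) := fun x => rfl
  refine OpenPartialHomeomorph.mem_maximalAtlas_of_contMDiffOn _ ?_ ?_
  · have : ContMDiffOn 𝓘(ℝ, SymTriple n m p) 𝓘(ℝ, SymTriple n m p) ∞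
        (fun x => (splitting n m p).symm (Φ.symm x)) Φ.target :=
      ((splitting n m p).symm.contDiff.comp_contDiffOn h2).contMDiffOn
    exact this.comp contMDiff_subtype_val.contMDiffOn fun x hx => (hsource x).1 hx
  · intro u hu
    refine ContMDiffAt.contMDiffWithinAt ?_
    refine (ContMDiffAt.iff_comp_isImmersionAtOfComplement (F := PUnit.{1})
      (Manifold.IsImmersionOfComplement.of_opens (N n m p) _)).2
        ⟨φ.continuousAt_symm hu, ?_⟩
    -- Followed by the inclusion of `N`, the inverse chart is `Φ` after `splitting`.
    refine (h1.comp (splitting n m p).contDiff).contMDiff.contMDiffAt.congr_of_eventuallyEq ?_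
    filter_upwards [φ.open_target.mem_nhds hu] with w hw
    have h3 := φ.map_target hw
    have h4 := φ.right_inv hw
    rw [hφx] at h4
    simp only [Function.comp_apply]
    conv_rhs => rw [← h4]
    rw [ContinuousLinearEquiv.apply_symm_apply, Φ.right_inv ((hsource _).1 h3)]

lemma mk_act (U : O n) (Θ : N n m p) :
    (Quotient.mk (MulAction.orbitRel (O n)ᵐᵒᵖ (N n m p)) (act U Θ)) = Quotient.mk _ Θ :=
  Quotient.sound ⟨MulOpposite.op U, rfl⟩

/-- Every point of `N` is the center of a chart adapted to the orbits of `O(n)`. -/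
theorem exists_orbitChart (Θ₀ : N n m p) :
    ∃ φ : OpenPartialHomeomorph (N n m p) (SymTriple n m p), Θ₀ ∈ φ.source ∧
      (splitting n m p (φ Θ₀)).1 = 0 ∧ OrbitChart (O n)ᵐᵒᵖ (splitting n m p) φ := by
  obtain ⟨σ, Φ, hΦ, h0, hΦs⟩ := exists_openPartialHomeomorph_sliceMap Θ₀.2.2.1
  have hΦ0 : Φ 0 = Θ₀ := by
    have := sliceMap_zero_right Θ₀.1 σ 0
    rw [map_zero, add_zero] at this
    rw [hΦ]
    exact this
  have hΦs0 : Φ.symm Θ₀ = 0 := by rw [← hΦ0, Φ.left_inv h0]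
  have hΘ₀ : (Θ₀ : SymTriple n m p) ∈ Φ.target := hΦ0 ▸ Φ.map_source h0
  -- `Φ` is injective on `A × B`, and `V` is so small that elements moving a point of `V` into `V`
  -- are Cayley transforms with parameter in `B`.
  obtain ⟨A, hA, B, hB, hAB⟩ := mem_nhds_prod_iff.1 (Φ.open_source.mem_nhds h0)
  obtain ⟨V, hV, hVB⟩ := exists_nhds_forall_act_mem Θ₀ (eventually_eq_cayley hB)
  have hV' : Subtype.val '' V ∈ 𝓝 (Θ₀ : SymTriple n m p) :=
    (N n m p).isOpen.isOpenMap_subtype_val.image_mem_nhds hV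
  -- Points whose slice coordinate is in `A` and whose slice point is in `V`, in particular in `N`.
  let W : Set (N n m p) := {x | (Φ.symm x).1 ∈ A ∧ Θ₀.1 + σ (Φ.symm x).1 ∈ Subtype.val '' V}
  have hW : W ∈ 𝓝 Θ₀ := by
    have hc : ContinuousAt (fun x : N n m p => (Φ.symm x).1) Θ₀ :=
      continuous_fst.continuousAt.comp
        ((Φ.continuousAt_symm hΘ₀).comp continuous_subtype_val.continuousAt)
    have hc' : ContinuousAt (fun x : N n m p => Θ₀.1 + σ (Φ.symm x).1) Θ₀ :=
      continuousAt_const.add (σ.continuous_of_finiteDimensional.continuousAt.comp hc)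
    have h1 : ∀ᶠ x : N n m p in 𝓝 Θ₀, (Φ.symm x).1 ∈ A := by
      refine hc.eventually_mem ?_
      rw [hΦs0]
      exact hA
    have h2 : ∀ᶠ x : N n m p in 𝓝 Θ₀, Θ₀.1 + σ (Φ.symm x).1 ∈ Subtype.val '' V := by
      refine hc'.eventually_mem ?_
      rw [hΦs0, Prod.fst_zero, map_zero, add_zero]
      exact hV'
    exact h1.and h2
  let φ := (((N n m p).openPartialHomeomorphSubtypeCoe ⟨Θ₀⟩).trans Φ.symm).transHomeomorph
        (splitting n m p).symm.toHomeomorph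
  have hφx : ∀ x, splitting n m p (φ x) = Φ.symm x := fun x =>
    (splitting n m p).apply_symm_apply _
  have hφ : φ ∈ IsManifold.maximalAtlas 𝓘(ℝ, SymTriple n m p) ∞ (N n m p) :=
    mem_maximalAtlas_N Θ₀ (hΦ ▸ contDiff_sliceMap _ _) hΦs
  have hsource : ∀ x, x ∈ φ.source ↔ (x : SymTriple n m p) ∈ Φ.target := fun x => by simp [φ]
  -- the normal form of points near `Θ₀`
  have hnf : ∀ x ∈ (φ.restr (interior W)).source, ∃ a ∈ V, ∃ U : O n, x = act U a ∧
      (Φ.symm x).1 ∈ A ∧ (a : SymTriple n m p) = Θ₀.1 + σ (Φ.symm x).1 := by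
    intro x hx
    rw [φ.restr_source' _ isOpen_interior] at hx
    obtain ⟨hxA, a, ha, hxa⟩ := interior_subset hx.2
    refine ⟨a, ha, ⟨_, cayley_mem_orthogonalGroup (skewCoord n (Φ.symm x).2).2⟩,
      Subtype.ext ?_, hxA, hxa⟩
    rw [coe_act, hxa]
    change _ = sliceMap Θ₀ σ (Φ.symm x)
    rw [← hΦ, Φ.right_inv ((hsource x).1 hx.1)]
  have hslice : ∀ s ∈ A, (s, (0 : OrbitModel n)) ∈ Φ.source := fun s hs =>
    hAB (mk_mem_prod hs (mem_of_mem_nhds hB))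
  refine ⟨φ.restr (interior W), ?_, ?_, ?_, fun y hy z hz => ?_⟩
  · rw [φ.restr_source' _ isOpen_interior]
    exact ⟨(hsource _).2 hΘ₀, mem_interior_iff_mem_nhds.2 hW⟩
  · change (splitting n m p (φ Θ₀)).1 = 0
    rw [hφx, hΦs0, Prod.fst_zero]
  · exact restr_mem_maximalAtlas (contDiffGroupoid ∞ _) hφ isOpen_interior
  · change _ ↔ (splitting n m p (φ y)).1 = (splitting n m p (φ z)).1
    rw [hφx, hφx]
    obtain ⟨a, ha, U, hya, hyA, hay⟩ := hnf y hy
    obtain ⟨b, hb, U', hzb, hzA, hbz⟩ := hnf z hz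
    have hmk : Quotient.mk (MulAction.orbitRel (O n)ᵐᵒᵖ (N n m p)) y = Quotient.mk _ z ↔
        Quotient.mk (MulAction.orbitRel (O n)ᵐᵒᵖ (N n m p)) a = Quotient.mk _ b := by
      rw [hya, hzb, mk_act, mk_act]
    rw [hmk]
    constructor
    · intro h
      obtain ⟨g, hg⟩ : ∃ g : (O n)ᵐᵒᵖ, g • b = a := Quotient.exact h
      have hg' : act g.unop b = a := hg
      obtain ⟨v, hv, hvg⟩ := hVB g.unop b hb (hg' ▸ ha)
      -- The slice point `a` is reached both directly and by moving the slice point `b`; both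
      -- parameters lie in `A × B`, so injectivity of `Φ` identifies the slice coordinates.
      have h1 : Φ ((Φ.symm z).1, v) = Φ ((Φ.symm y).1, 0) := by
        rw [hΦ, sliceMap_zero_right, ← hay, ← hg', coe_act, ← hvg, hbz]
        rfl
      exact (congrArg Prod.fst (Φ.injOn (hAB (mk_mem_prod hzA hv)) (hslice _ hyA) h1)).symm
    · intro h
      rw [h, ← hbz] at hay
      rw [Subtype.ext hay]

end SymSys

end Preliminaries

theorem mainTheorem3 (n m p : ℕ) :
    -- the similarity action of `GL(n)` on minimal triples is free
    (∀ Θ : SymSys.MinimalTriple n m p,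
      MulAction.stabilizer (GL (Fin n) ℝ)ᵐᵒᵖ Θ = ⊥) ∧
    -- the action of `O(n)` on `N` is smooth, free and proper, and `O(n)` is compact
    (∀ U : SymSys.O n, ContMDiff 𝓘(ℝ, SymSys.SymTriple n m p) 𝓘(ℝ, SymSys.SymTriple n m p) ∞
      (SymSys.act U : SymSys.N n m p → SymSys.N n m p)) ∧
    (∀ Θ : SymSys.N n m p, MulAction.stabilizer (SymSys.O n)ᵐᵒᵖ Θ = ⊥) ∧
    CompactSpace (SymSys.O n) ∧
    ProperSMul (SymSys.O n)ᵐᵒᵖ (SymSys.N n m p) ∧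
    -- `N / O(n)` is a topological manifold with a unique smooth structure making the canonical
    -- projection a smooth submersion
    T2Space (SymSys.NQuot n m p) ∧
    SecondCountableTopology (SymSys.NQuot n m p) ∧
    (∃ cs : ChartedSpace (EuclideanSpace ℝ (Fin (n * (m + p + 1)))) (SymSys.NQuot n m p),
      SymSys.IsQuotientManifold cs ∧
      ∀ cs' : ChartedSpace (EuclideanSpace ℝ (Fin (n * (m + p + 1)))) (SymSys.NQuot n m p),
        SymSys.IsQuotientManifold cs' →
          @IsManifold.maximalAtlas ℝ _ _ _ _ _ _ (𝓡 (n * (m + p + 1))) ∞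
              (SymSys.NQuot n m p) _ cs' =
            @IsManifold.maximalAtlas ℝ _ _ _ _ _ _ (𝓡 (n * (m + p + 1))) ∞
              (SymSys.NQuot n m p) _ cs) ∧
    -- every fiber of the canonical projection is an embedded submanifold of `N`
    (∀ Θ : SymSys.N n m p,
      ∃ _ : ChartedSpace (EuclideanSpace ℝ (Fin (n.choose 2)))
          ↥((SymSys.proj : SymSys.N n m p → SymSys.NQuot n m p) ⁻¹' {SymSys.proj Θ}),
        IsManifold (𝓡 (n.choose 2)) ∞
          ↥((SymSys.proj : SymSys.N n m p → SymSys.NQuot n m p) ⁻¹' {SymSys.proj Θ}) ∧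
        Manifold.IsSmoothEmbedding (𝓡 (n.choose 2)) 𝓘(ℝ, SymSys.SymTriple n m p) ∞
          (Subtype.val :
            ↥((SymSys.proj : SymSys.N n m p → SymSys.NQuot n m p) ⁻¹' {SymSys.proj Θ}) →
              SymSys.N n m p)) := by
  refine ⟨SymSys.stabilizer_GL_eq_bot, SymSys.contMDiff_act, SymSys.stabilizer_O_eq_bot,
    inferInstance, inferInstance, inferInstance, inferInstance, ?_, fun Θ => ?_⟩
  · obtain ⟨cs, hm, hs⟩ := exists_chartedSpace_orbitQuotient (G := (SymSys.O n)ᵐᵒᵖ)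
      (ℓ := SymSys.splitting n m p) (M := SymSys.N n m p)
      (fun g => SymSys.contMDiff_act g.unop) fun Θ => by
        obtain ⟨φ, h1, -, h2⟩ := SymSys.exists_orbitChart Θ
        exact ⟨φ, h1, h2⟩
    refine ⟨cs, ⟨hm, hs⟩, fun cs' hcs' => ?_⟩
    have hsurj : Function.Surjective (SymSys.proj : SymSys.N n m p → SymSys.NQuot n m p) :=
      Quotient.mk_surjective
    exact (maximalAtlas_subset_of_isSubmersion hsurj cs' cs hm hcs'.isSubmersion hs).antisymm
      (maximalAtlas_subset_of_isSubmersion hsurj cs cs' hcs'.isManifold hs hcs'.isSubmersion)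
  · exact exists_chartedSpace_orbitFiber (G := (SymSys.O n)ᵐᵒᵖ) SymSys.exists_orbitChart
      (SymSys.proj Θ)
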